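/- Let $k$ be a field and let $X$ be a finite set. **Setting.** A relation on $X$ is a subset of $X\times X$; relations are multiplied by composition, $RS=\{(x,z)\mid \exists y,\ (x,y)\in R,\ (y,z)\in S\}$. A relation $R$ on $X$ is *inessential* if $R=ST$ for some $S\subseteq X\times Y$ and $T\subseteq Y\times X$ with $Y$ a finite set of cardinality $|Y|<|X|$, and *essential* otherwise. Let $\mathcal E$ be the quotient of the $k$-algebra of the monoid of all relations on $X$ by the two-sided ideal spanned by the inessential relations. Let $\Sigma$ be the group of permutations of $X$ and, for $\sigma\in\Sigma$, let $\Delta_\sigma=\{(\sigma(x),x)\mid x\in X\}$. Let $N$ be the two-sided ideal of $\mathcal E$ that is $k$-spanned by the elements $(S-\overline S)\Delta_\sigma$, where $S$ is a reflexive essential relation, $\overline S$ is its transitive closure and $\sigma\in\Sigma$, and let $\mathcal P=\mathcal E/N$. Let $\mathcal O$ be the set of partial orders on $X$ (viewed as relations), ordered by inclusion, with Möbius function $\mu$. The group $\Sigma$ acts on $\mathcal O$ by ${}^\sigma R=\Delta_\sigma R\Delta_{\sigma^{-1}}$; let $\Sigma_R$ be the stabilizer of $R$. For $R\in\mathcal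 O$ let $f_R=\sum_{S\in\mathcal O,\ R\subseteq S}\mu(R,S)\,S\in\mathcal P$. We have $\Delta_h f_R=f_R\Delta_h$ for $h\in\Sigma_R$, so that the left ideal $\mathcal P f_R$ is a $(\mathcal P,k\Sigma_R)$-bimodule, $h\in\Sigma_R$ acting on the right by multiplication by $\Delta_h$. Let $\mathcal W$ be the set of all pairs $(R,V)$ where $R\in\mathcal O$ and $V$ is a simple $k\Sigma_R$-module up to isomorphism. The group $\Sigma$ acts on $\mathcal W$ by ${}^\sigma(R,V)=({}^\sigma R,{}^\sigma V)$, where ${}^\sigma V$ is $V$ with $h\in\Sigma_{{}^\sigma R}=\sigma\Sigma_R\sigma^{-1}$ acting as $\sigma^{-1}h\sigma$. "Module" means left module. **Theorem.** 1. Inflation along $\mathcal E\to\mathcal P$ is a bijection from the isomorphism classes of simple $\mathcal P$-modules to the isomorphism classes of simple $\mathcal E$-modules. 2. There is a bijection from the set $\Sigma\backslash\mathcal W$ of $\Sigma$-conjugacy classes of pairs to the set of isomorphism classes of simple $\mathcal P$-modules, $[(R,V)]\mapsto[S_{R,V}]$, with the following properties. (i) Choose, for every $R\in\mathcal O$, a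 set $[\Sigma/\Sigma_R]$ of representatives of the cosets $\Sigma/\Sigma_R$. Then there are $k$-algebra homomorphisms $\phi_R:\mathcal P\to M_{|\Sigma:\Sigma_R|}(k\Sigma_R)$, for $R\in\mathcal O$, with rows and columns indexed by $[\Sigma/\Sigma_R]$, describing the action of $\mathcal P$ by left multiplication on the right $k\Sigma_R$-module $\mathcal P f_R$ with respect to the elements $\Delta_\sigma f_R$, $\sigma\in[\Sigma/\Sigma_R]$, that is $$x\,\Delta_\sigma f_R=\sum_{\tau\in[\Sigma/\Sigma_R]}\Delta_\tau f_R\cdot\phi_R(x)_{\tau\sigma}\qquad(x\in\mathcal P,\ \sigma\in[\Sigma/\Sigma_R]),$$ and such that for every set $[\Sigma\backslash\mathcal O]$ of representatives of the $\Sigma$-orbits in $\mathcal O$ the map $(\phi_R)_R:\mathcal P\to\prod_{R\in[\Sigma\backslash\mathcal O]}M_{|\Sigma:\Sigma_R|}(k\Sigma_R)$ is an isomorphism. The algebra $M_{|\Sigma:\Sigma_R|}(k)$ has a unique simple module $W_R$ up to isomorphism, and $S_{R,V}\cong W_R\otimes_k V$, on which $\mathcal P$ acts via $\phi_R$ and $M_{|\Sigma:\Sigma_R|}(k\Sigma_R)\cong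 M_{|\Sigma:\Sigma_R|}(k)\otimes_k k\Sigma_R$. (ii) $S_{R,V}\cong\mathcal P f_R\otimes_{k\Sigma_R}V$, with $\mathcal P$ acting by left multiplication. (iii) $V$ is finite-dimensional and $\dim_k S_{R,V}=|\Sigma:\Sigma_R|\cdot\dim_k V$. -/

import Mathlib

open scoped TensorProduct

universe u v w

/-- The type of relations on `X`, i.e. subsets of `X × X`. -/
def BinRel (X : Type v) : Type v := SetRel X X

namespace BinRel

variable {X : Type v}

/-- `R.Holds x y` means `(x, y) ∈ R`. -/
def Holds (R : BinRel X) (x y : X) : Prop := (x, y) ∈ (show Set (X × X) from R)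

theorem ext {R S : BinRel X} (h : ∀ x y, R.Holds x y ↔ S.Holds x y) : R = S :=
  Set.ext fun p => h p.1 p.2

/-- The monoid of relations: the product is the composition of relations
`RS = {(x, z) | ∃ y, (x, y) ∈ R ∧ (y, z) ∈ S}` and the unit is the diagonal. -/
instance : Monoid (BinRel X) where
  mul R S := SetRel.comp R S
  one := SetRel.id
  mul_assoc R S T := SetRel.comp_assoc R S T
  one_mul R := SetRel.id_comp R
  mul_one R := SetRel.comp_id R

theorem holds_mul {R S : BinRel X} {x z : X} :
    (R * S).Holds x z ↔ ∃ y, R.Holds x y ∧ S.Holds y z := Iff.rfl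

theorem holds_one {x y : X} : (1 : BinRel X).Holds x y ↔ x = y := Iff.rfl

/-- A relation on `X` is inessential if it is a composite `ST` with `S ⊆ X × Y`, `T ⊆ Y × X`
for some finite set `Y` of cardinality smaller than that of `X`. -/
def Inessential (R : BinRel X) : Prop :=
  ∃ (Y : Type v) (_ : Finite Y), Nat.card Y < Nat.card X ∧
    ∃ (S : SetRel X Y) (T : SetRel Y X), R = SetRel.comp S T

/-- A relation is essential if it is not inessential. -/
def Essential (R : BinRel X) : Prop := ¬ R.Inessential

/-- The relation `Δ_σ = {(σ x, x) | x ∈ X}`. -/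
def perm (σ : Equiv.Perm X) : BinRel X := {p : X × X | p.1 = σ p.2}

/-- The transitive closure of a relation. -/
def transClosure (R : BinRel X) : BinRel X := {p : X × X | Relation.TransGen R.Holds p.1 p.2}

/-- Reflexive relations. -/
def IsReflexive (R : BinRel X) : Prop := ∀ x, R.Holds x x

theorem holds_perm {σ : Equiv.Perm X} {x y : X} : (perm σ).Holds x y ↔ x = σ y := Iff.rfl

theorem holds_transClosure {R : BinRel X} {x y : X} :
    R.transClosure.Holds x y ↔ Relation.TransGen R.Holds x y := Iff.rfl

theorem perm_one : perm (1 : Equiv.Perm X) = 1 := rfl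

theorem perm_mul (σ τ : Equiv.Perm X) : perm (σ * τ) = perm σ * perm τ := by
  refine ext fun x y => ?_
  simp [holds_mul, holds_perm]

theorem holds_perm_mul {σ : Equiv.Perm X} {R : BinRel X} {x y : X} :
    (perm σ * R).Holds x y ↔ R.Holds (σ⁻¹ x) y := by
  simp only [holds_mul, holds_perm]
  constructor
  · rintro ⟨z, rfl, h⟩; simpa using h
  · intro h; exact ⟨σ⁻¹ x, by simp, h⟩

theorem holds_mul_perm {σ : Equiv.Perm X} {R : BinRel X} {x y : X} :
    (R * perm σ).Holds x y ↔ R.Holds x (σ y) := by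
  simp [holds_mul, holds_perm]

theorem holds_conj {σ : Equiv.Perm X} {R : BinRel X} {x y : X} :
    (perm σ * R * perm σ⁻¹).Holds x y ↔ R.Holds (σ⁻¹ x) (σ⁻¹ y) := by
  rw [holds_mul_perm, holds_perm_mul]

theorem Inessential.mul_left {R : BinRel X} (h : R.Inessential) (Q : BinRel X) :
    (Q * R).Inessential := by
  obtain ⟨Y, hY, hc, S, T, rfl⟩ := h
  exact ⟨Y, hY, hc, SetRel.comp Q S, T, (SetRel.comp_assoc _ _ _).symm⟩

theorem Inessential.mul_right {R : BinRel X} (h : R.Inessential) (Q : BinRel X) :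
    (R * Q).Inessential := by
  obtain ⟨Y, hY, hc, S, T, rfl⟩ := h
  exact ⟨Y, hY, hc, S, SetRel.comp T Q, SetRel.comp_assoc _ _ _⟩

theorem Inessential.transClosure {R : BinRel X} (h : R.Inessential) :
    R.transClosure.Inessential := by
  have key : R.transClosure =
      R * (show BinRel X from {p : X × X | Relation.ReflTransGen R.Holds p.1 p.2}) :=
    ext fun x y => by
      rw [holds_transClosure, Relation.TransGen.head'_iff]; rfl
  rw [key]
  exact h.mul_right _

theorem transClosure_conj (σ : Equiv.Perm X) (R : BinRel X) :
    (perm σ * R * perm σ⁻¹).transClosure = perm σ * R.transClosure * perm σ⁻¹ := by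
  refine ext fun x y => ?_
  rw [holds_conj, holds_transClosure, holds_transClosure]
  constructor
  · intro h
    exact Relation.TransGen.lift (σ⁻¹ : Equiv.Perm X) (fun a b hab => holds_conj.1 hab) _ _ h
  · intro h
    have := Relation.TransGen.lift (p := (perm σ * R * perm σ⁻¹).Holds) σ
      (fun a b hab => holds_conj.2 (by simpa using hab)) _ _ h
    simpa [Function.onFun] using this

theorem transClosure_mono {R S : BinRel X} (h : ∀ x y, R.Holds x y → S.transClosure.Holds x y)
    {x y : X} (hxy : R.transClosure.Holds x y) : S.transClosure.Holds x y := by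
  rw [holds_transClosure] at hxy
  induction hxy with
  | single h1 => exact h _ _ h1
  | tail _ h1 ih => exact Relation.TransGen.trans ih (h _ _ h1)

theorem IsReflexive.mul {R S : BinRel X} (hR : R.IsReflexive) (hS : S.IsReflexive) :
    (R * S).IsReflexive := fun x => ⟨x, hR x, hS x⟩

theorem IsReflexive.transClosure {R : BinRel X} (hR : R.IsReflexive) :
    R.transClosure.IsReflexive := fun x => .single (hR x)

theorem IsReflexive.conj {R : BinRel X} (hR : R.IsReflexive) (σ : Equiv.Perm X) :
    (perm σ * R * perm σ⁻¹).IsReflexive := fun _ => holds_conj.2 (hR _)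

theorem transClosure_mul_left {R S : BinRel X} (hR : R.IsReflexive) (hS : S.IsReflexive) :
    (R * S.transClosure).transClosure = (R * S).transClosure := by
  refine ext fun x y => ⟨transClosure_mono ?_, transClosure_mono ?_⟩
  · rintro x z ⟨y, h1, h2⟩
    refine Relation.TransGen.trans (.single ⟨y, h1, hS y⟩) ?_
    exact Relation.TransGen.mono (fun a b hab => ⟨a, hR a, hab⟩) _ _ h2
  · rintro x z ⟨y, h1, h2⟩
    exact .single ⟨y, h1, .single h2⟩

theorem transClosure_mul_right {R S : BinRel X} (hR : R.IsReflexive) (hS : S.IsReflexive) :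
    (S.transClosure * R).transClosure = (S * R).transClosure := by
  refine ext fun x y => ⟨transClosure_mono ?_, transClosure_mono ?_⟩
  · rintro x z ⟨y, h1, h2⟩
    refine Relation.TransGen.trans ?_ (.single ⟨y, hS y, h2⟩)
    exact Relation.TransGen.mono (fun a b hab => ⟨b, hab, hR b⟩) _ _ h1
  · rintro x z ⟨y, h1, h2⟩
    exact .single ⟨y, .single h1, h2⟩

/-- An essential relation contains a permutation. -/
theorem Essential.exists_perm [Finite X] {R : BinRel X} (h : R.Essential) :
    ∃ σ : Equiv.Perm X, ∀ x, R.Holds (σ x) x := by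
  classical
  have := Fintype.ofFinite X
  let t : X → Finset X := fun y => Finset.univ.filter fun x => R.Holds x y
  have hall : ∀ A : Finset X, A.card ≤ (A.biUnion t).card := by
    intro A
    by_contra hA
    push Not at hA
    refine h ⟨{y // y ∉ A} ⊕ {x // x ∈ A.biUnion t}, inferInstance, ?_,
      {p | Sum.elim (fun y => R.Holds p.1 y.1) (fun x => p.1 = x.1) p.2},
      {p | Sum.elim (fun y => p.2 = y.1) (fun x => R.Holds x.1 p.2) p.1}, ?_⟩
    · rw [Nat.card_eq_fintype_card, Nat.card_eq_fintype_card, Fintype.card_sum,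
        Fintype.card_coe]
      have h1 : Fintype.card {y // y ∉ A} = Fintype.card X - A.card := by
        rw [Fintype.card_subtype_compl, Fintype.card_coe]
      have h2 := A.card_le_univ
      omega
    · refine ext fun x y => ⟨fun hxy => ?_, ?_⟩
      · by_cases hy : y ∈ A
        · exact ⟨.inr ⟨x, Finset.mem_biUnion.2 ⟨y, hy, by simpa [t] using hxy⟩⟩, rfl, hxy⟩
        · exact ⟨.inl ⟨y, hy⟩, hxy, rfl⟩
      · rintro ⟨y' | x', h1, h2⟩
        · have h2 : y = y'.1 := h2
          subst h2; exact h1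
        · have h1 : x = x'.1 := h1
          subst h1; exact h2
  obtain ⟨f, hf, hft⟩ := (Finset.all_card_le_biUnion_card_iff_exists_injective t).1 hall
  refine ⟨Equiv.ofBijective f (Finite.injective_iff_bijective.1 hf), fun x => ?_⟩
  simpa [t] using hft x

end BinRel

section Algebras

variable (k : Type u) [CommRing k] (X : Type v)

/-- The two-sided ideal of the algebra of all relations on `X` which is `k`-linearly spanned by the
inessential relations. -/
noncomputable def inessentialIdeal : Ideal (MonoidAlgebra k (BinRel X)) where
  __ := Submodule.span k
    {a | ∃ R : BinRel X, R.Inessential ∧ a = MonoidAlgebra.of k (BinRel X) R}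
  smul_mem' := by
    intro c x hx
    change x ∈ Submodule.span k _ at hx
    change c * x ∈ Submodule.span k _
    induction hx using Submodule.span_induction with
    | mem x h =>
      obtain ⟨R, hR, rfl⟩ := h
      induction c using MonoidAlgebra.induction_on with
      | of Q => exact Submodule.subset_span ⟨Q * R, hR.mul_left Q, (map_mul _ _ _).symm⟩
      | add a b ha hb => rw [add_mul]; exact add_mem ha hb
      | smul r a ha => rw [smul_mul_assoc]; exact Submodule.smul_mem _ r ha
    | zero => simp
    | add a b _ _ ha hb => rw [mul_add]; exact add_mem ha hb
    | smul r a _ ha => rw [mul_smul_comm]; exact Submodule.smul_mem _ r ha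

instance : (inessentialIdeal k X).IsTwoSided where
  mul_mem_of_left := by
    intro x c hx
    change x ∈ Submodule.span k _ at hx
    change x * c ∈ Submodule.span k _
    induction hx using Submodule.span_induction with
    | mem x h =>
      obtain ⟨R, hR, rfl⟩ := h
      induction c using MonoidAlgebra.induction_on with
      | of Q => exact Submodule.subset_span ⟨R * Q, hR.mul_right Q, (map_mul _ _ _).symm⟩
      | add a b ha hb => rw [mul_add]; exact add_mem ha hb
      | smul r a ha => rw [mul_smul_comm]; exact Submodule.smul_mem _ r ha
    | zero => simp
    | add a b _ _ ha hb => rw [add_mul]; exact add_mem ha hb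
    | smul r a _ ha => rw [smul_mul_assoc]; exact Submodule.smul_mem _ r ha

/-- The essential algebra: the quotient of the algebra of the monoid of relations on `X` by the
ideal spanned by the inessential relations. -/
def EssentialAlgebra : Type (max u v) := MonoidAlgebra k (BinRel X) ⧸ inessentialIdeal k X

noncomputable instance : Ring (EssentialAlgebra k X) :=
  inferInstanceAs (Ring (MonoidAlgebra k (BinRel X) ⧸ inessentialIdeal k X))

noncomputable instance : Algebra k (EssentialAlgebra k X) :=
  inferInstanceAs (Algebra k (MonoidAlgebra k (BinRel X) ⧸ inessentialIdeal k X))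

variable {X} in
/-- The class of a relation in the essential algebra. -/
noncomputable def essClass : BinRel X →* EssentialAlgebra k X where
  toFun R := Ideal.Quotient.mk (inessentialIdeal k X) (MonoidAlgebra.of k (BinRel X) R)
  map_one' := by rw [map_one, map_one]; rfl
  map_mul' R S := by rw [map_mul, map_mul]; rfl

variable {k X} in
theorem essClass_eq_zero {R : BinRel X} (hR : R.Inessential) : essClass k R = 0 :=
  Ideal.Quotient.eq_zero_iff_mem.2 (Submodule.subset_span ⟨R, hR, rfl⟩)

variable {k X} in
theorem essentialAlgebra_induction {p : EssentialAlgebra k X → Prop} (a : EssentialAlgebra k X)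
    (hcls : ∀ R : BinRel X, R.Essential → p (essClass k R)) (zero : p 0)
    (add : ∀ a b, p a → p b → p (a + b)) (smul : ∀ (r : k) a, p a → p (r • a)) : p a := by
  obtain ⟨a, rfl⟩ := Ideal.Quotient.mk_surjective a
  induction a using MonoidAlgebra.induction_on with
  | of Q =>
    by_cases hQ : Q.Inessential
    · have := essClass_eq_zero (k := k) hQ
      change p (essClass k Q)
      rw [this]; exact zero
    · exact hcls Q hQ
  | add a b ha hb => rw [map_add]; exact add _ _ ha hb
  | smul r a ha => exact smul r _ ha

/-- The `k`-submodule of the essential algebra generated by all the elements `(S - S̄) Δ_σ`, where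
`S` is a reflexive essential relation, `S̄` its transitive closure, and `σ` a permutation. -/
noncomputable def nilSubmodule : Submodule k (EssentialAlgebra k X) :=
  Submodule.span k {a | ∃ (S : BinRel X) (σ : Equiv.Perm X), S.IsReflexive ∧ S.Essential ∧
    a = (essClass k S - essClass k S.transClosure) * essClass k (BinRel.perm σ)}

variable {k X}

theorem sub_mul_mem_nilSubmodule {S : BinRel X} (hS : S.IsReflexive) (σ : Equiv.Perm X) :
    (essClass k S - essClass k S.transClosure) * essClass k (BinRel.perm σ) ∈
      nilSubmodule k X := by
  by_cases h : S.Inessential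
  · rw [essClass_eq_zero h, essClass_eq_zero h.transClosure, sub_zero, zero_mul]
    exact zero_mem _
  · exact Submodule.subset_span ⟨S, σ, hS, h, rfl⟩

theorem perm_mul_mem_nilSubmodule {S : BinRel X} (hS : S.IsReflexive) (τ σ : Equiv.Perm X) :
    essClass k (BinRel.perm τ) *
      ((essClass k S - essClass k S.transClosure) * essClass k (BinRel.perm σ)) ∈
      nilSubmodule k X := by
  have := sub_mul_mem_nilSubmodule (k := k) (hS.conj τ) (τ * σ)
  rw [BinRel.transClosure_conj, BinRel.perm_mul] at this
  simp only [map_mul, ← sub_mul, ← mul_sub, ← mul_assoc] at this ⊢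
  have h1 : essClass k (BinRel.perm τ⁻¹) * essClass k (BinRel.perm τ) = 1 := by
    rw [← map_mul, ← BinRel.perm_mul, inv_mul_cancel, BinRel.perm_one, map_one]
  rwa [mul_assoc _ (essClass k (BinRel.perm τ⁻¹)), h1, mul_one] at this

theorem mul_mem_nilSubmodule [Finite X] (a : EssentialAlgebra k X) {x : EssentialAlgebra k X}
    (hx : x ∈ nilSubmodule k X) : a * x ∈ nilSubmodule k X := by
  induction hx using Submodule.span_induction with
  | zero => simp
  | add a b _ _ ha hb => rw [mul_add]; exact add_mem ha hb
  | smul r a _ ha => rw [mul_smul_comm]; exact Submodule.smul_mem _ r ha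
  | mem x h =>
    obtain ⟨S, σ, hS, -, rfl⟩ := h
    induction a using essentialAlgebra_induction with
    | zero => simp
    | add a b ha hb => rw [add_mul]; exact add_mem ha hb
    | smul r a ha => rw [smul_mul_assoc]; exact Submodule.smul_mem _ r ha
    | hcls R hR =>
    obtain ⟨τ, hτ⟩ := hR.exists_perm
    set Q : BinRel X := BinRel.perm τ⁻¹ * R with hQdef
    have hQ : Q.IsReflexive := fun x => by
      rw [hQdef, BinRel.holds_perm_mul]; simpa using hτ x
    have hRQ : R = BinRel.perm τ * Q := by
      rw [hQdef, ← mul_assoc, ← BinRel.perm_mul, mul_inv_cancel, BinRel.perm_one, one_mul]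
    have h1 := perm_mul_mem_nilSubmodule (k := k) (hQ.mul hS) τ σ
    have h2 := perm_mul_mem_nilSubmodule (k := k) (hQ.mul hS.transClosure) τ σ
    rw [BinRel.transClosure_mul_left hQ hS] at h2
    have h3 := sub_mem h1 h2
    rw [hRQ]
    convert h3 using 1
    simp only [map_mul]
    noncomm_ring

theorem mul_mem_nilSubmodule' [Finite X] (a : EssentialAlgebra k X) {x : EssentialAlgebra k X}
    (hx : x ∈ nilSubmodule k X) : x * a ∈ nilSubmodule k X := by
  induction hx using Submodule.span_induction with
  | zero => simp
  | add a b _ _ ha hb => rw [add_mul]; exact add_mem ha hb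
  | smul r a _ ha => rw [smul_mul_assoc]; exact Submodule.smul_mem _ r ha
  | mem x h =>
    obtain ⟨S, σ, hS, -, rfl⟩ := h
    induction a using essentialAlgebra_induction with
    | zero => simp
    | add a b ha hb => rw [mul_add]; exact add_mem ha hb
    | smul r a ha => rw [mul_smul_comm]; exact Submodule.smul_mem _ r ha
    | hcls R hR =>
    obtain ⟨τ, hτ⟩ := hR.exists_perm
    set Q : BinRel X := BinRel.perm σ * (R * BinRel.perm τ⁻¹) * BinRel.perm σ⁻¹ with hQdef
    have hQ : Q.IsReflexive := BinRel.IsReflexive.conj (fun x => by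
      rw [BinRel.holds_mul_perm]; simpa using hτ (τ⁻¹ x)) σ
    have hRQ : BinRel.perm σ * R = Q * BinRel.perm (σ * τ) := by
      rw [hQdef, BinRel.perm_mul]
      have e1 : BinRel.perm σ⁻¹ * BinRel.perm σ = 1 := by
        rw [← BinRel.perm_mul, inv_mul_cancel, BinRel.perm_one]
      have e2 : BinRel.perm τ⁻¹ * BinRel.perm τ = 1 := by
        rw [← BinRel.perm_mul, inv_mul_cancel, BinRel.perm_one]
      calc BinRel.perm σ * R = BinRel.perm σ * (R * 1) * 1 := by simp
        _ = BinRel.perm σ * (R * (1 * (BinRel.perm τ⁻¹ * BinRel.perm τ))) := by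
          rw [e2]; simp
        _ = _ := by
          rw [← e1, mul_assoc _ (BinRel.perm σ⁻¹), ← mul_assoc (BinRel.perm σ⁻¹), e1]
          simp only [one_mul, mul_assoc]
    have h1 := sub_mul_mem_nilSubmodule (k := k) (hS.mul hQ) (σ * τ)
    have h2 := sub_mul_mem_nilSubmodule (k := k) (hS.transClosure.mul hQ) (σ * τ)
    rw [BinRel.transClosure_mul_right hQ hS] at h2
    have h3 := sub_mem h1 h2
    rw [mul_assoc, ← map_mul, hRQ]
    convert h3 using 1
    simp only [map_mul]
    noncomm_ring

variable (k X) [Finite X]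

/-- The submodule `nilSubmodule` as an ideal. -/
noncomputable def nilIdeal : Ideal (EssentialAlgebra k X) where
  __ := nilSubmodule k X
  smul_mem' a _ hx := mul_mem_nilSubmodule a hx

instance : (nilIdeal k X).IsTwoSided where
  mul_mem_of_left a hx := mul_mem_nilSubmodule' a hx

/-- The algebra of permuted orders. -/
def PermutedOrderAlgebra : Type (max u v) := EssentialAlgebra k X ⧸ nilIdeal k X

noncomputable instance : Ring (PermutedOrderAlgebra k X) :=
  inferInstanceAs (Ring (EssentialAlgebra k X ⧸ nilIdeal k X))

noncomputable instance : Algebra k (PermutedOrderAlgebra k X) :=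
  inferInstanceAs (Algebra k (EssentialAlgebra k X ⧸ nilIdeal k X))

/-- The quotient map from the essential algebra to the algebra of permuted orders. -/
noncomputable def toPermutedOrderAlgebra : EssentialAlgebra k X →ₐ[k] PermutedOrderAlgebra k X :=
  Ideal.Quotient.mkₐ k (nilIdeal k X)

theorem toPermutedOrderAlgebra_surjective :
    Function.Surjective (toPermutedOrderAlgebra k X) :=
  Ideal.Quotient.mkₐ_surjective k (nilIdeal k X)

variable {X} in
/-- The class of a relation in the algebra of permuted orders. -/
noncomputable def relClass : BinRel X →* PermutedOrderAlgebra k X where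
  toFun R := toPermutedOrderAlgebra k X (essClass k R)
  map_one' := by rw [map_one, map_one]
  map_mul' R S := by rw [map_mul, map_mul]

variable {X} in
/-- The class of `Δ_σ` in the algebra of permuted orders. -/
noncomputable def permClass : Equiv.Perm X →* PermutedOrderAlgebra k X where
  toFun σ := relClass k (BinRel.perm σ)
  map_one' := by rw [BinRel.perm_one, map_one]
  map_mul' σ τ := by rw [BinRel.perm_mul, map_mul]

end Algebras

/-- The set of all (partial) orders on `X`, viewed as relations. -/
@[ext] structure OrderRel (X : Type v) where
  /-- The underlying relation. -/
  rel : BinRel X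
  refl : ∀ x, rel.Holds x x
  trans : ∀ x y z, rel.Holds x y → rel.Holds y z → rel.Holds x z
  antisymm : ∀ x y, rel.Holds x y → rel.Holds y x → x = y

namespace OrderRel

variable {X : Type v}

theorem rel_injective : Function.Injective (OrderRel.rel : OrderRel X → BinRel X) := fun _ _ => OrderRel.ext

/-- Orders are ordered by containment of the corresponding subsets of `X × X`. -/
instance : PartialOrder (OrderRel X) :=
  PartialOrder.lift (fun R : OrderRel X => (show Set (X × X) from R.rel)) rel_injective

theorem le_iff {R S : OrderRel X} : R ≤ S ↔ ∀ x y, R.rel.Holds x y → S.rel.Holds x y :=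
  ⟨fun h x y => @h (x, y), fun h p => h p.1 p.2⟩

/-- The symmetric group acts on orders by conjugation, `σ • R = Δ_σ R Δ_{σ⁻¹}`. -/
instance : MulAction (Equiv.Perm X) (OrderRel X) where
  smul σ R :=
    { rel := BinRel.perm σ * R.rel * BinRel.perm σ⁻¹
      refl := fun _ => BinRel.holds_conj.2 (R.refl _)
      trans := fun _ _ _ h1 h2 =>
        BinRel.holds_conj.2 (R.trans _ _ _ (BinRel.holds_conj.1 h1) (BinRel.holds_conj.1 h2))
      antisymm := fun _ _ h1 h2 => (σ⁻¹ : Equiv.Perm X).injective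
        (R.antisymm _ _ (BinRel.holds_conj.1 h1) (BinRel.holds_conj.1 h2)) }
  one_smul R := OrderRel.ext (BinRel.ext fun _ _ => BinRel.holds_conj)
  mul_smul σ τ R := OrderRel.ext (BinRel.ext fun x y =>
    BinRel.holds_conj.trans (by
      rw [mul_inv_rev]; exact (BinRel.holds_conj.trans BinRel.holds_conj).symm))

theorem smul_rel (σ : Equiv.Perm X) (R : OrderRel X) :
    (σ • R).rel = BinRel.perm σ * R.rel * BinRel.perm σ⁻¹ := rfl

theorem smul_le_smul (σ : Equiv.Perm X) {R S : OrderRel X} (h : R ≤ S) : σ • R ≤ σ • S :=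
  le_iff.2 fun _ _ hxy => BinRel.holds_conj.2 (le_iff.1 h _ _ (BinRel.holds_conj.1 hxy))

theorem smul_le_smul_iff (σ : Equiv.Perm X) {R S : OrderRel X} : σ • R ≤ σ • S ↔ R ≤ S :=
  ⟨fun h => by simpa using smul_le_smul σ⁻¹ h, smul_le_smul σ⟩

/-- The stabilizer `Σ_R` of an order `R` in the symmetric group. -/
abbrev stab (R : OrderRel X) : Subgroup (Equiv.Perm X) := MulAction.stabilizer (Equiv.Perm X) R

instance [Finite X] : Finite (OrderRel X) :=
  have : Finite (BinRel X) := inferInstanceAs (Finite (Set (X × X)))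
  Finite.of_injective _ rel_injective

noncomputable instance [Finite X] : Fintype (OrderRel X) := Fintype.ofFinite _

noncomputable instance : DecidableEq (OrderRel X) := Classical.decEq _

noncomputable instance : DecidableLE (OrderRel X) := Classical.decRel _

noncomputable instance : DecidableLT (OrderRel X) := Classical.decRel _

noncomputable instance [Finite X] : LocallyFiniteOrder (OrderRel X) := Fintype.toLocallyFiniteOrder

noncomputable instance [Finite X] (R : OrderRel X) : Fintype (Equiv.Perm X ⧸ R.stab) :=
  Fintype.ofFinite _

noncomputable instance (R : OrderRel X) : DecidableEq (Equiv.Perm X ⧸ R.stab) := Classical.decEq _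

theorem mu_smul [Finite X] (σ : Equiv.Perm X) (R S : OrderRel X) :
    IncidenceAlgebra.mu ℤ (σ • R) (σ • S) = IncidenceAlgebra.mu ℤ R S := by
  induction S using WellFoundedLT.induction with
  | ind S ih =>
    rw [IncidenceAlgebra.mu_apply (a := σ • R), IncidenceAlgebra.mu_apply (a := R) (b := S)]
    simp only [smul_left_cancel_iff]
    congr 2
    refine (Finset.sum_bij (fun T _ => σ • T) ?_ ?_ ?_ ?_).symm
    · intro T hT
      rw [Finset.mem_Ico, lt_iff_le_not_ge] at *
      simpa only [smul_le_smul_iff] using hT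
    · intro T _ T' _ h
      exact smul_left_cancel _ h
    · intro T hT
      refine ⟨σ⁻¹ • T, ?_, smul_inv_smul _ _⟩
      rw [← smul_inv_smul σ T] at hT
      rw [Finset.mem_Ico, lt_iff_le_not_ge] at *
      simpa only [smul_le_smul_iff] using hT
    · intro T hT
      exact (ih T (Finset.mem_Ico.1 hT).2).symm

end OrderRel

section Idempotents

variable (k : Type u) [CommRing k] {X : Type v} [Finite X]

/-- The idempotent `f_R = ∑_{R ⊆ S} μ(R, S) S`, where `S` runs over the orders containing `R` and
`μ` is the Möbius function of the poset of orders. -/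
noncomputable def fIdem (R : OrderRel X) : PermutedOrderAlgebra k X :=
  ∑ S : OrderRel X with R ≤ S, IncidenceAlgebra.mu ℤ R S • relClass k S.rel

/-- The `k`-algebra map from the group algebra of `Σ_R` which sends `h` to `Δ_h`. -/
noncomputable def stabMap (R : OrderRel X) : MonoidAlgebra k R.stab →ₐ[k] PermutedOrderAlgebra k X :=
  MonoidAlgebra.lift k (PermutedOrderAlgebra k X) R.stab ((permClass k).comp R.stab.subtype)

theorem permClass_mul_fIdem (σ : Equiv.Perm X) (R : OrderRel X) :
    permClass k σ * fIdem k R = fIdem k (σ • R) * permClass k σ := by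
  unfold fIdem
  rw [Finset.mul_sum, Finset.sum_mul]
  refine Finset.sum_bij (fun S _ => σ • S) ?_ ?_ ?_ ?_
  · intro S hS
    simpa [OrderRel.smul_le_smul_iff] using hS
  · intro T _ T' _ h
    exact smul_left_cancel _ h
  · intro T hT
    refine ⟨σ⁻¹ • T, ?_, smul_inv_smul _ _⟩
    rw [Finset.mem_filter] at *
    rw [← OrderRel.smul_le_smul_iff σ, smul_inv_smul]
    simpa using hT
  · intro S _
    rw [OrderRel.mu_smul, mul_smul_comm, smul_mul_assoc, OrderRel.smul_rel]
    change _ • (relClass k _ * _) = _ • (_ * relClass k _)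
    rw [← map_mul, ← map_mul, mul_assoc, ← BinRel.perm_mul, inv_mul_cancel, BinRel.perm_one,
      mul_one]

theorem stabMap_mul_fIdem (R : OrderRel X) (a : MonoidAlgebra k R.stab) :
    stabMap k R a * fIdem k R = fIdem k R * stabMap k R a := by
  induction a using MonoidAlgebra.induction_on with
  | of h =>
    have e : stabMap k R (MonoidAlgebra.of k R.stab h) = permClass k (h : Equiv.Perm X) := by
      simp [stabMap]
    have e2 : (h : Equiv.Perm X) • R = R := h.2
    rw [e, permClass_mul_fIdem, e2]
  | add x y hx hy => rw [map_add, add_mul, mul_add, hx, hy]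
  | smul r x hx => rw [map_smul, smul_mul_assoc, mul_smul_comm, hx]

/-- The left ideal `𝒫 f_R`. -/
noncomputable def leftIdealF (R : OrderRel X) : Ideal (PermutedOrderAlgebra k X) :=
  Ideal.span {fIdem k R}

/-- The left ideal `𝒫 f_R` is a right `kΣ_R`-module via `x · h = x Δ_h`. -/
noncomputable instance (R : OrderRel X) : Module (MonoidAlgebra k R.stab)ᵐᵒᵖ (leftIdealF k R) where
  smul a x := ⟨x.1 * stabMap k R a.unop, by
    obtain ⟨y, hy⟩ := Ideal.mem_span_singleton'.1 x.2
    exact Ideal.mem_span_singleton'.2 ⟨y * stabMap k R a.unop, by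
      rw [mul_assoc, stabMap_mul_fIdem, ← mul_assoc, hy]⟩⟩
  one_smul x := Subtype.ext (by
    change x.1 * stabMap k R 1 = x.1
    rw [map_one, mul_one])
  mul_smul a b x := Subtype.ext (by
    change x.1 * stabMap k R (b.unop * a.unop) =
      x.1 * stabMap k R b.unop * stabMap k R a.unop
    rw [map_mul, mul_assoc])
  smul_zero a := Subtype.ext (zero_mul _)
  smul_add a x y := Subtype.ext (add_mul _ _ _)
  add_smul a b x := Subtype.ext (by
    change x.1 * stabMap k R (a.unop + b.unop) =
      x.1 * stabMap k R a.unop + x.1 * stabMap k R b.unop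
    rw [map_add, mul_add])
  zero_smul x := Subtype.ext (by
    change x.1 * stabMap k R 0 = 0
    rw [map_zero, mul_zero])

end Idempotents

/-- The tensor product `M ⊗_A N` over a (not necessarily commutative) `k`-algebra `A` of a
`(B, A)`-bimodule `M` and a left `A`-module `N`, as a left `B`-module: it is the quotient of
`M ⊗_k N` by the elements `m a ⊗ n - m ⊗ a n`. -/
abbrev BimodTensor (k A B M N : Type*) [CommRing k] [Ring A] [Algebra k A] [Ring B] [Algebra k B]
    [AddCommGroup M] [Module k M] [Module B M] [IsScalarTower k B M] [Module Aᵐᵒᵖ M]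
    [AddCommGroup N] [Module k N] [Module A N] : Type _ :=
  (M ⊗[k] N) ⧸ Submodule.span B
    {t : M ⊗[k] N | ∃ (m : M) (a : A) (n : N), t = (MulOpposite.op a • m) ⊗ₜ[k] n - m ⊗ₜ[k] (a • n)}

/-- If `W` is a module over `Mat_n(k)` and `V` is a module over the `k`-algebra `A`, then `W ⊗_k V`
is a module over `Mat_n(k) ⊗_k A ≅ Mat_n(A)`; this is the corresponding map to endomorphisms. -/
noncomputable def matrixTensorEnd (k n A W V : Type*) [CommRing k] [Fintype n] [DecidableEq n]
    [Ring A] [Algebra k A] [AddCommGroup W] [Module k W] [Module (Matrix n n k) W]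
    [IsScalarTower k (Matrix n n k) W] [AddCommGroup V] [Module k V] [Module A V]
    [IsScalarTower k A V] : Matrix n n A →ₐ[k] Module.End k (W ⊗[k] V) :=
  ((Module.endTensorEndAlgHom (R := k) (S := k) (A := k) (M := W) (N := V)).comp
    (Algebra.TensorProduct.map (Algebra.lsmul k k W) (Algebra.lsmul k k V))).comp
    (((matrixEquivTensor n k A).trans
      (Algebra.TensorProduct.comm k A (Matrix n n k))).toAlgHom)

section SimpleModules

/-- Simple left modules over a ring `A`. -/
abbrev SimpleMod (A : Type u) [Ring A] : Type (max u (w + 1)) :=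
  {M : ModuleCat.{w} A // IsSimpleModule A M}

/-- Isomorphism of simple modules. -/
instance simpleModSetoid (A : Type u) [Ring A] : Setoid (SimpleMod.{u, w} A) where
  r M N := Nonempty (M.1 ≃ₗ[A] N.1)
  iseqv := ⟨fun _ => ⟨LinearEquiv.refl _ _⟩, fun ⟨e⟩ => ⟨e.symm⟩, fun ⟨e⟩ ⟨f⟩ => ⟨e.trans f⟩⟩

/-- The collection of isomorphism classes of simple left `A`-modules. -/
def SimpleIso (A : Type u) [Ring A] : Type (max u (w + 1)) :=
  Quotient (simpleModSetoid.{u, w} A)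

/-- The isomorphism class of a simple module. -/
def SimpleMod.cls {A : Type u} [Ring A] (M : SimpleMod.{u, w} A) : SimpleIso.{u, w} A :=
  Quotient.mk _ M

variable {A : Type u} {B : Type v} [Ring A] [Ring B]

/-- The restriction of scalars of a simple module along a surjective ring homomorphism. -/
noncomputable def SimpleMod.restrict (f : A →+* B) (hf : Function.Surjective f) (M : SimpleMod.{v, w} B) :
    SimpleMod.{u, w} A :=
  ⟨(ModuleCat.restrictScalars f).obj M.1, by
    have : RingHomSurjective f := ⟨hf⟩
    let l : (ModuleCat.restrictScalars f).obj M.1 →ₛₗ[f] M.1 :=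
      { toFun := fun x => x, map_add' := fun _ _ => rfl, map_smul' := fun _ _ => rfl }
    exact (LinearMap.isSimpleModule_iff_of_bijective l Function.bijective_id).2 M.2⟩

/-- Restriction of scalars along a surjective ring homomorphism, on isomorphism classes. -/
noncomputable def SimpleIso.restrict (f : A →+* B) (hf : Function.Surjective f) :
    SimpleIso.{v, w} B → SimpleIso.{u, w} A :=
  Quotient.map (SimpleMod.restrict f hf) fun _ _ ⟨e⟩ =>
    ⟨{ e with map_smul' := fun a x => e.map_smul (f a) x }⟩

theorem SimpleIso.restrict_restrict {C : Type*} [Ring C] (f : A →+* B) (hf : Function.Surjective f)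
    (g : B →+* C) (hg : Function.Surjective g) (x : SimpleIso.{_, w} C) :
    (x.restrict g hg).restrict f hf = x.restrict (g.comp f) (hg.comp hf) := by
  induction x using Quotient.inductionOn
  exact Quotient.sound ⟨{ AddEquiv.refl _ with map_smul' := fun _ _ => rfl }⟩

theorem SimpleIso.restrict_id (x : SimpleIso.{u, w} A) :
    x.restrict (RingHom.id A) Function.surjective_id = x := by
  induction x using Quotient.inductionOn
  exact Quotient.sound ⟨{ AddEquiv.refl _ with map_smul' := fun _ _ => rfl }⟩

end SimpleModules

section Pairs

variable (k : Type u) [Field k] (X : Type v)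

/-- The set of pairs `(R, V)`, where `R` is an order on `X` and `V` is an isomorphism class of
simple `kΣ_R`-modules. -/
def OrderPair : Type (max u v (w + 1)) :=
  Σ R : OrderRel X, SimpleIso.{max u v, w} (MonoidAlgebra k R.stab)

variable {X}

/-- The ring isomorphism `kΣ_{σR} → kΣ_R`, `h ↦ σ⁻¹ h σ`. -/
noncomputable def conjHom (σ : Equiv.Perm X) (R : OrderRel X) :
    MonoidAlgebra k (σ • R).stab →+* MonoidAlgebra k R.stab :=
  MonoidAlgebra.mapDomainRingHom k
    ((MulAction.stabilizerEquivStabilizer (rfl : σ • R = σ • R)).symm :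
      (σ • R).stab →* R.stab)

theorem mapDomainRingHom_surjective {G H : Type*} [Monoid G] [Monoid H] {f : G →* H}
    (hf : Function.Surjective f) : Function.Surjective (MonoidAlgebra.mapDomainRingHom k f) := by
  intro x
  induction x using MonoidAlgebra.induction_on with
  | of h =>
    obtain ⟨g, rfl⟩ := hf h
    exact ⟨MonoidAlgebra.of k G g, by simp⟩
  | add x y hx hy =>
    obtain ⟨x', rfl⟩ := hx
    obtain ⟨y', rfl⟩ := hy
    exact ⟨x' + y', map_add _ _ _⟩
  | smul r x hx =>
    obtain ⟨x', rfl⟩ := hx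
    exact ⟨r • x', map_smul (MonoidAlgebra.mapDomainAlgHom k k f) r x'⟩

theorem conjHom_surjective (σ : Equiv.Perm X) (R : OrderRel X) :
    Function.Surjective (conjHom k σ R) :=
  mapDomainRingHom_surjective k (MulEquiv.surjective _)

variable {k} in
theorem orderPair_eq {R R₁ R₂ : OrderRel X} (h : R₁ = R₂) (f₁ : R₁.stab →* R.stab)
    (f₂ : R₂.stab →* R.stab) (h₁ : Function.Surjective f₁) (h₂ : Function.Surjective f₂)
    (h₁₂ : ∀ (g : Equiv.Perm X) (g₁ : g ∈ R₁.stab) (g₂ : g ∈ R₂.stab), f₁ ⟨g, g₁⟩ = f₂ ⟨g, g₂⟩)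
    (V : SimpleIso.{max u v, w} (MonoidAlgebra k R.stab)) :
    (⟨R₁, V.restrict _ (mapDomainRingHom_surjective k h₁)⟩ : OrderPair.{u, v, w} k X) =
      ⟨R₂, V.restrict _ (mapDomainRingHom_surjective k h₂)⟩ := by
  subst h
  have : f₁ = f₂ := by ext1 g; exact h₁₂ g.1 g.2 g.2
  subst this
  rfl

/-- The symmetric group acts on pairs by `σ • (R, V) = (σR, σV)`, where the conjugate module `σV` is
`V` with `h ∈ Σ_{σR} = σ Σ_R σ⁻¹` acting as `σ⁻¹ h σ`. -/
noncomputable instance : MulAction (Equiv.Perm X) (OrderPair.{u, v, w} k X) where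
  smul σ p := ⟨σ • p.1, p.2.restrict (conjHom k σ p.1) (conjHom_surjective k σ p.1)⟩
  one_smul := by
    rintro ⟨R, V⟩
    refine (orderPair_eq (one_smul _ R) _ (MonoidHom.id _) (MulEquiv.surjective _)
      Function.surjective_id ?_ V).trans ?_
    · intro g _ _
      ext1
      simp [MulAction.stabilizerEquivStabilizer_symm_apply]
    · simp only [MonoidAlgebra.mapDomainRingHom_id]
      exact congrArg (Sigma.mk R) (SimpleIso.restrict_id V)
  mul_smul := by
    rintro σ τ ⟨R, V⟩
    refine (orderPair_eq (mul_smul σ τ R) _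
      (((MulAction.stabilizerEquivStabilizer (rfl : τ • R = τ • R)).symm : (τ • R).stab →* R.stab).comp
        ((MulAction.stabilizerEquivStabilizer (rfl : σ • τ • R = σ • τ • R)).symm :
          (σ • τ • R).stab →* (τ • R).stab))
      (MulEquiv.surjective _) (by
        rw [MonoidHom.coe_comp]
        exact (MulEquiv.surjective _).comp (MulEquiv.surjective _)) ?_ V).trans ?_
    · intro g _ _
      ext1
      simp [MulAction.stabilizerEquivStabilizer_symm_apply, mul_assoc]
    · simp only [MonoidAlgebra.mapDomainRingHom_comp]
      exact congrArg (Sigma.mk (σ • τ • R)) (SimpleIso.restrict_restrict _ _ _ _ V).symm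

variable {k} in
/-- The class in `Σ \ 𝒲` of the pair `(R, V)`. -/
noncomputable def pairClass (R : OrderRel X) (V : SimpleMod.{max u v, w} (MonoidAlgebra k R.stab)) :
    MulAction.orbitRel.Quotient (Equiv.Perm X) (OrderPair.{u, v, w} k X) :=
  Quotient.mk _ ⟨R, V.cls⟩

end Pairs

section Main

variable {k : Type u} [Field k] {X : Type v} [Finite X]

open scoped ModuleCat

/-- The left `𝒫`-module `𝒫 f_R ⊗_{kΣ_R} V`. -/
noncomputable def inducedModule (R : OrderRel X)
    (V : ModuleCat.{max u v w} (MonoidAlgebra k R.stab)) :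
    ModuleCat.{max u v w} (PermutedOrderAlgebra k X) :=
  ModuleCat.of (PermutedOrderAlgebra k X)
    (BimodTensor k (MonoidAlgebra k R.stab) (PermutedOrderAlgebra k X) (leftIdealF k R) V)

/-- Given representatives `s` of the cosets in `Σ / Σ_R`, the matrix-valued map `φ` describes the
action of `𝒫` by left multiplication on the right `kΣ_R`-module `𝒫 f_R` with respect to the family
`Δ_σ f_R`, for `σ` in the image of `s`. -/
def IsLeftMulMatrix (R : OrderRel X) (s : Equiv.Perm X ⧸ R.stab → Equiv.Perm X)
    (φ : PermutedOrderAlgebra k X →ₐ[k] Matrix (Equiv.Perm X ⧸ R.stab) (Equiv.Perm X ⧸ R.stab)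
      (MonoidAlgebra k R.stab)) : Prop :=
  ∀ (x : PermutedOrderAlgebra k X) (j : Equiv.Perm X ⧸ R.stab),
    x * (permClass k (s j) * fIdem k R) =
      ∑ i, permClass k (s i) * fIdem k R * stabMap k R (φ x i j)

/-- The `𝒫`-module `W ⊗_k V`, for a `Mat(k)`-module `W` and a `kΣ_R`-module `V`, where `𝒫` acts via
`φ : 𝒫 → Mat(kΣ_R) ≅ Mat(k) ⊗_k kΣ_R`. -/
noncomputable def matrixTensorModule {R : OrderRel X}
    (φ : PermutedOrderAlgebra k X →ₐ[k] Matrix (Equiv.Perm X ⧸ R.stab) (Equiv.Perm X ⧸ R.stab)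
      (MonoidAlgebra k R.stab))
    (W : ModuleCat.{max u v w} (Matrix (Equiv.Perm X ⧸ R.stab) (Equiv.Perm X ⧸ R.stab) k))
    (V : ModuleCat.{max u v w} (MonoidAlgebra k R.stab)) :
    ModuleCat.{max u v w} (PermutedOrderAlgebra k X) :=
  @ModuleCat.of (PermutedOrderAlgebra k X) _ (W ⊗[k] V) _
    (Module.compHom (W ⊗[k] V)
      ((matrixTensorEnd k (Equiv.Perm X ⧸ R.stab) (MonoidAlgebra k R.stab) W V).comp
        φ).toRingHom)

/-- The dimension over the field `k` of a module over a `k`-algebra. -/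
noncomputable def dimOver (k : Type u) [Field k] {A : Type v} [Ring A] [Algebra k A]
    (M : ModuleCat.{w} A) : Cardinal.{w} := Module.rank k M

end Main

/-! Modulo inessential relations and modulo `N`, a reflexive relation becomes the class of its
transitive closure. That closure is a preorder: either it is an order, or it identifies two distinct
points and factors through `X` minus a point, hence vanishes. By Hall's theorem an essential
relation is `Δ_σ` times a reflexive one, so `𝒫` is spanned by the elements `Δ_σ S` with `S` an
order. The product of two orders is their join, or zero if they have no common upper bound
(`OrderRel.relClass_mul`). Möbius inversion in this semilattice turns the orders into orthogonal
idempotents `f_R` with sum `1`, permuted by conjugation, and `S f_R` is `f_R` or `0` according to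
whether `S ≤ R` (`relClass_mul_fIdem`).

Hence `𝒫 f_R` is spanned by the `Δ_σ f_R`. Independence comes from the linear form `unitCoeff`,
which tests `1 ⊆ T ⊆ R`; it descends to `𝒫` because an order contains no nontrivial permutation. So
`𝒫 f_R` is free over `kΣ_R` on the coset representatives (`leftIdealCoord_permClass_mul`), left
multiplication is given by matrices, and the elements `Δ_σ f_R a Δ_τ⁻¹` act as matrix units. With `1
= ∑ f_R` this gives the product decomposition `bijective_leftMulMatrix`.

Simple modules are classified through corners. Since `f_R 𝒫 f_R = f_R kΣ_R`, a simple module `M`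
with `f_R M ≠ 0` is determined by the simple `kΣ_R`-module `f_R M`, and a change of `R` within its
orbit only conjugates this module. `HasCorner k R V M` records `f_R M ≅ V`; both `W_R ⊗ V` and `𝒫
f_R ⊗ V` satisfy it, so they are isomorphic, and the bijection amounts to this single relation
(`simpleOfPair_eq_iff`).

Finally `N` acts by zero on simple `ℰ`-modules: right multiplication by an element of `N` strictly
raises the size of the relations `S` occurring in `(S - S̄) Δ_σ` (`closureDiff_mul_mem`), so
elements of `N` are nilpotent. -/

/-! ### Reflexive relations, orders and essentiality. -/

namespace BinRel

variable {X : Type v}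

/-- A reflexive relation contained in an order is essential. -/
theorem IsReflexive.essential_of_le {T : BinRel X} (hT : T.IsReflexive) {R : OrderRel X}
    (h : ∀ x y, T.Holds x y → R.rel.Holds x y) : T.Essential := by
  rintro ⟨Y, hY, hc, S, U, rfl⟩
  choose f hf using hT
  -- `f x` is a point through which the loop at `x` factors; a shared point yields both `(x, y)` and
  -- `(y, x)`, against antisymmetry.
  have hinj : Function.Injective f := fun x y hxy =>
    R.antisymm x y (h x y ⟨f x, (hf x).1, hxy ▸ (hf y).2⟩)
      (h y x ⟨f y, (hf y).1, hxy ▸ (hf x).2⟩)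
  exact absurd (Nat.card_le_card_of_injective f hinj) (not_le.2 hc)

/-- A transitive reflexive relation which is not antisymmetric is inessential. -/
theorem inessential_of_not_antisymm [Finite X] {T : BinRel X} (hT : T.IsReflexive)
    (htr : ∀ x y z, T.Holds x y → T.Holds y z → T.Holds x z) {a b : X} (hab : T.Holds a b)
    (hba : T.Holds b a) (hne : a ≠ b) : T.Inessential := by
  -- The point `b` can be omitted because `a`, equivalent to it in the preorder, serves as
  -- intermediate point in its place.
  refine ⟨{z // z ≠ b}, inferInstance, Finite.card_subtype_lt (x := b) (by simp),
    {p | T.Holds p.1 p.2.1}, {p | T.Holds p.1.1 p.2}, ext fun x z => ⟨fun h => ?_, ?_⟩⟩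
  · by_cases hx : x = b
    · exact ⟨⟨a, hne⟩, hx ▸ hba, htr _ _ _ hab (hx ▸ h)⟩
    · exact ⟨⟨x, hx⟩, hT x, h⟩
  · rintro ⟨y, h1, h2⟩
    exact htr _ _ _ h1 h2

theorem transClosure_holds_trans {R : BinRel X} (x y z : X) (h : R.transClosure.Holds x y)
    (h' : R.transClosure.Holds y z) : R.transClosure.Holds x z :=
  Relation.TransGen.trans h h'

theorem transClosure_le {S : BinRel X} {R : OrderRel X}
    (h : ∀ x y, S.Holds x y → R.rel.Holds x y) {x y : X} (hxy : S.transClosure.Holds x y) :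
    R.rel.Holds x y := by
  rw [holds_transClosure] at hxy
  induction hxy with
  | single h1 => exact h _ _ h1
  | tail _ h1 ih => exact R.trans _ _ _ ih (h _ _ h1)

end BinRel

namespace OrderRel

variable {X : Type v}

/-- A permutation contained in an order is trivial. -/
theorem perm_eq_one [Finite X] {R : OrderRel X} {σ : Equiv.Perm X} (h : ∀ x, R.rel.Holds (σ x) x) :
    σ = 1 := by
  have hpow : ∀ (m : ℕ) x, R.rel.Holds ((σ ^ m) x) x := by
    intro m
    induction m with
    | zero => exact fun x => R.refl x
    | succ m ih =>
      intro x
      rw [pow_succ']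
      exact R.trans _ _ _ (h _) (ih x)
  -- Finite order makes `σ⁻¹` a nonnegative power of `σ`, so transitivity also puts the reversed
  -- pairs into `R`.
  have hinv : σ⁻¹ = σ ^ (orderOf σ - 1) := by
    rw [inv_eq_iff_mul_eq_one, ← pow_succ', Nat.sub_add_cancel (orderOf_pos σ), pow_orderOf_eq_one]
  ext x
  refine R.antisymm _ _ (h x) ?_
  simpa [← hinv] using hpow (orderOf σ - 1) (σ x)

theorem isReflexive (R : OrderRel X) : R.rel.IsReflexive := R.refl

/-- The transitive closure of a reflexive relation contained in an order, as an order. -/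
def closure (S : BinRel X) (hS : S.IsReflexive)
    (h : ∀ x y, S.transClosure.Holds x y → S.transClosure.Holds y x → x = y) : OrderRel X where
  rel := S.transClosure
  refl := hS.transClosure
  trans := BinRel.transClosure_holds_trans
  antisymm := h

/-- The discrete order. -/
def discrete (X : Type v) : OrderRel X where
  rel := 1
  refl _ := BinRel.holds_one.2 rfl
  trans _ _ _ h1 h2 := h1.trans h2
  antisymm _ _ h _ := h

theorem discrete_le (R : OrderRel X) : discrete X ≤ R :=
  le_iff.2 fun x y h => by
    obtain rfl : x = y := h
    exact R.refl x

theorem mul_rel_of_le {S T : OrderRel X} (h : S ≤ T) : S.rel * T.rel = T.rel :=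
  BinRel.ext fun x _ => ⟨fun ⟨z, h1, h2⟩ => T.trans _ z _ (le_iff.1 h _ _ h1) h2,
    fun h1 => ⟨x, S.refl x, h1⟩⟩

end OrderRel

/-! ### Orders as a join-semilattice with zero, and the Möbius idempotents. -/

section Relations

variable {k : Type u} [CommRing k] {X : Type v} [Finite X]

theorem relClass_eq_zero {R : BinRel X} (hR : R.Inessential) : relClass k R = 0 := by
  change toPermutedOrderAlgebra k X (essClass k R) = 0
  rw [essClass_eq_zero hR, map_zero]

theorem relClass_transClosure {S : BinRel X} (hS : S.IsReflexive) :
    relClass k S = relClass k S.transClosure := by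
  have h := sub_mul_mem_nilSubmodule (k := k) hS 1
  rw [BinRel.perm_one, map_one, mul_one] at h
  have h2 : toPermutedOrderAlgebra k X (essClass k S - essClass k S.transClosure) = 0 :=
    Ideal.Quotient.eq_zero_iff_mem.2 h
  rw [map_sub, sub_eq_zero] at h2
  exact h2

/-- The class of a reflexive relation is zero or the class of an order, namely of its transitive
closure. -/
theorem relClass_reflexive {S : BinRel X} (hS : S.IsReflexive) :
    (relClass k S = 0 ∧ ∀ R : OrderRel X, ¬ ∀ x y, S.Holds x y → R.rel.Holds x y) ∨
      ∃ T : OrderRel X, relClass k S = relClass k T.rel ∧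
        ∀ R : OrderRel X, T ≤ R ↔ ∀ x y, S.Holds x y → R.rel.Holds x y := by
  -- The closure is a preorder in any case; antisymmetry decides between an order and zero.
  by_cases h : ∀ x y, S.transClosure.Holds x y → S.transClosure.Holds y x → x = y
  · refine .inr ⟨OrderRel.closure S hS h, relClass_transClosure hS, fun R => ?_⟩
    rw [OrderRel.le_iff]
    exact ⟨fun hR x y hxy => hR x y (.single hxy), fun hR x y hxy => BinRel.transClosure_le hR hxy⟩
  · push Not at h
    obtain ⟨a, b, hab, hba, hne⟩ := h
    refine .inl ⟨?_, fun R hR => hne (R.antisymm _ _ (BinRel.transClosure_le hR hab)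
      (BinRel.transClosure_le hR hba))⟩
    rw [relClass_transClosure hS]
    exact relClass_eq_zero (BinRel.inessential_of_not_antisymm hS.transClosure
      BinRel.transClosure_holds_trans hab hba hne)

theorem BinRel.Essential.exists_eq_perm_mul {R : BinRel X} (h : R.Essential) :
    ∃ (σ : Equiv.Perm X) (Q : BinRel X), Q.IsReflexive ∧ R = BinRel.perm σ * Q := by
  obtain ⟨τ, hτ⟩ := h.exists_perm
  refine ⟨τ, BinRel.perm τ⁻¹ * R, fun x => ?_, ?_⟩
  · rw [BinRel.holds_perm_mul]; simpa using hτ x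
  · rw [← mul_assoc, ← BinRel.perm_mul, mul_inv_cancel, BinRel.perm_one, one_mul]

/-- The algebra of permuted orders is spanned by the elements `Δ_σ S`. -/
theorem permutedOrderAlgebra_induction {p : PermutedOrderAlgebra k X → Prop}
    (x : PermutedOrderAlgebra k X)
    (hcls : ∀ (σ : Equiv.Perm X) (S : OrderRel X), p (permClass k σ * relClass k S.rel))
    (zero : p 0) (add : ∀ a b, p a → p b → p (a + b)) (smul : ∀ (r : k) a, p a → p (r • a)) :
    p x := by
  obtain ⟨a, rfl⟩ := toPermutedOrderAlgebra_surjective k X x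
  induction a using essentialAlgebra_induction with
  | hcls R hR =>
    obtain ⟨σ, Q, hQ, rfl⟩ := hR.exists_eq_perm_mul
    change p (relClass k (BinRel.perm σ * Q))
    rw [map_mul]
    obtain ⟨h, -⟩ | ⟨T, h, -⟩ := relClass_reflexive (k := k) hQ
    · rw [h, mul_zero]; exact zero
    · rw [h]; exact hcls σ T
  | zero => rwa [map_zero]
  | add a b ha hb => rw [map_add]; exact add _ _ ha hb
  | smul r a ha => rw [map_smul]; exact smul r _ ha

/-- Both factors are reflexive, so `ST` contains `S` and `T`, and an order containing both contains
`ST` by transitivity. The closure of `ST` is therefore the join when it is an order; otherwise no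
common upper bound exists. -/
theorem OrderRel.relClass_mul (S T : OrderRel X) :
    (relClass k S.rel * relClass k T.rel = 0 ∧ ∀ R : OrderRel X, ¬ (S ≤ R ∧ T ≤ R)) ∨
      ∃ U : OrderRel X, relClass k S.rel * relClass k T.rel = relClass k U.rel ∧
        ∀ R : OrderRel X, U ≤ R ↔ S ≤ R ∧ T ≤ R := by
  rw [← map_mul]
  have key : ∀ R : OrderRel X, (S ≤ R ∧ T ≤ R) ↔
      ∀ x y, (S.rel * T.rel).Holds x y → R.rel.Holds x y := by
    intro R
    rw [OrderRel.le_iff, OrderRel.le_iff]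
    constructor
    · rintro ⟨h1, h2⟩ x y ⟨z, hz, hz'⟩
      exact R.trans _ z _ (h1 _ _ hz) (h2 _ _ hz')
    · exact fun h => ⟨fun x y hxy => h x y ⟨y, hxy, T.refl y⟩,
        fun x y hxy => h x y ⟨x, S.refl x, hxy⟩⟩
  simp only [key]
  exact relClass_reflexive (S.isReflexive.mul T.isReflexive)

/-- Möbius inversion of the definition of `f_R`: after exchanging the sums, the coefficient of `T`
is the sum of `μ(S, T)` over the interval `[R, T]`. -/
theorem relClass_eq_sum_fIdem (R : OrderRel X) :
    relClass k R.rel = ∑ S : OrderRel X with R ≤ S, fIdem k S := by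
  classical
  symm
  calc ∑ S : OrderRel X with R ≤ S, fIdem k S
      = ∑ T : OrderRel X, ∑ S : OrderRel X,
          (if R ≤ S ∧ S ≤ T then IncidenceAlgebra.mu ℤ S T else 0) • relClass k T.rel := by
        rw [Finset.sum_comm, Finset.sum_filter]
        refine Finset.sum_congr rfl fun S _ => ?_
        by_cases h : R ≤ S
        · simp [h, fIdem, Finset.sum_filter, ite_smul]
        · simp [h]
    _ = ∑ T : OrderRel X, (if R = T then (1 : ℤ) else 0) • relClass k T.rel := by
        refine Finset.sum_congr rfl fun T _ => ?_
        rw [← Finset.sum_smul, ← IncidenceAlgebra.sum_Icc_mu_left, ← Finset.sum_filter]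
        congr 2
        ext S
        simp
    _ = relClass k R.rel := by simp [ite_smul]

/-- An order `S` acts on `f_R` by `1` if `S ⊆ R` and by `0` otherwise. -/
theorem relClass_mul_fIdem (S R : OrderRel X) :
    relClass k S.rel * fIdem k R = if S ≤ R then fIdem k R else 0 := by
  -- Downward induction: `f_R` is `R` minus the `f_T` with `T > R`, on which the action of `S` is
  -- already known.
  induction R using WellFoundedGT.induction generalizing S with
  | ind R ih =>
    have hR : fIdem k R = relClass k R.rel - ∑ T : OrderRel X with R < T, fIdem k T := by
      rw [eq_sub_iff_add_eq, relClass_eq_sum_fIdem]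
      have : Finset.univ.filter (R ≤ ·) = insert R (Finset.univ.filter (R < ·)) := by
        ext T
        simp [le_iff_eq_or_lt, eq_comm]
      rw [this, Finset.sum_insert (by simp)]
    have hsum : relClass k S.rel * ∑ T : OrderRel X with R < T, fIdem k T =
        ∑ T : OrderRel X with R < T ∧ S ≤ T, fIdem k T := by
      rw [Finset.mul_sum, ← Finset.filter_filter, Finset.sum_filter (S ≤ ·)]
      exact Finset.sum_congr rfl fun T hT => ih T (by simpa using hT) S
    split_ifs with h
    · rw [hR, mul_sub, hsum, ← map_mul, OrderRel.mul_rel_of_le h]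
      congr 2
      ext T
      simpa using fun hT : R < T => h.trans hT.le
    · rw [hR, mul_sub, hsum, sub_eq_zero]
      obtain ⟨h0, hU⟩ | ⟨U, h0, hU⟩ := OrderRel.relClass_mul (k := k) S R
      · rw [h0, Finset.filter_false_of_mem, Finset.sum_empty]
        exact fun T _ hT => hU T ⟨hT.2, hT.1.le⟩
      -- The join `U` of `S` and `R` expands as the sum of `f_T` over `T ≥ U`. Since `S ≰ R`, these
      -- are exactly the `T > R` with `S ≤ T`, so the two terms cancel.
      · rw [h0, relClass_eq_sum_fIdem]
        congr 1
        ext T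
        simp only [Finset.mem_filter, Finset.mem_univ, true_and, hU]
        refine ⟨fun hT => ⟨lt_of_le_of_ne hT.2 ?_, hT.1⟩, fun hT => ⟨hT.2, hT.1.le⟩⟩
        rintro rfl
        exact h hT.1

/-- Only the terms `T ≤ S` of the left factor act nontrivially on `f_S`, leaving the sum of `μ(R,
T)` over `[R, S]`, which vanishes unless `R = S`. -/
theorem fIdem_mul_fIdem (R S : OrderRel X) :
    fIdem k R * fIdem k S = if R = S then fIdem k S else 0 := by
  have h1 : fIdem k R * fIdem k S =
      ∑ T ∈ Finset.Icc R S, IncidenceAlgebra.mu ℤ R T • fIdem k S := by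
    conv_lhs => rw [fIdem]
    rw [Finset.sum_mul]
    have : Finset.Icc R S = (Finset.univ.filter (R ≤ ·)).filter (· ≤ S) := by
      ext; simp
    rw [this, Finset.sum_filter (· ≤ S)]
    refine Finset.sum_congr rfl fun T _ => ?_
    rw [smul_mul_assoc, relClass_mul_fIdem]
    split_ifs <;> simp
  rw [h1, ← Finset.sum_smul, IncidenceAlgebra.sum_Icc_mu_right]
  split_ifs <;> simp

theorem fIdem_mul_self (R : OrderRel X) : fIdem k R * fIdem k R = fIdem k R := by
  rw [fIdem_mul_fIdem, if_pos rfl]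

/-- The discrete order is both the least order and the unit of the monoid; this is Möbius inversion
at it. -/
theorem sum_fIdem : ∑ R : OrderRel X, fIdem k R = 1 := by
  have := relClass_eq_sum_fIdem (k := k) (OrderRel.discrete X)
  rw [Finset.filter_true_of_mem fun R _ => OrderRel.discrete_le R] at this
  rw [← this]
  exact map_one (relClass k)

theorem fIdem_mul_permClass_mul_fIdem (R S : OrderRel X) (σ : Equiv.Perm X) :
    fIdem k R * (permClass k σ * fIdem k S) =
      if R = σ • S then permClass k σ * fIdem k S else 0 := by
  rw [permClass_mul_fIdem, ← mul_assoc, fIdem_mul_fIdem]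
  split_ifs <;> simp

/-- `𝒫 f_R` is spanned by the elements `Δ_σ f_R`. -/
theorem mul_fIdem_induction {R : OrderRel X} {p : PermutedOrderAlgebra k X → Prop}
    (x : PermutedOrderAlgebra k X) (hcls : ∀ σ : Equiv.Perm X, p (permClass k σ * fIdem k R))
    (zero : p 0) (add : ∀ a b, p a → p b → p (a + b)) (smul : ∀ (r : k) a, p a → p (r • a)) :
    p (x * fIdem k R) := by
  induction x using permutedOrderAlgebra_induction with
  | hcls σ S =>
    rw [mul_assoc, relClass_mul_fIdem]
    split_ifs
    · exact hcls σ
    · rwa [mul_zero]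
  | zero => rwa [zero_mul]
  | add a b ha hb => rw [add_mul]; exact add _ _ ha hb
  | smul r a ha => rw [smul_mul_assoc]; exact smul r _ ha

end Relations

/-! ### A linear form separating the elements `Δ_σ f_R`. -/

section Coefficient

variable (k : Type u) [CommRing k] {X : Type v}

open Classical in
/-- The indicator of `1 ⊆ T ⊆ R`. -/
noncomputable def betweenIndicator (R : OrderRel X) (T : BinRel X) : k :=
  if T.IsReflexive ∧ ∀ x y, T.Holds x y → R.rel.Holds x y then 1 else 0

variable {k} in
theorem betweenIndicator_eq_zero {R : OrderRel X} {T : BinRel X} (h : T.Inessential) :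
    betweenIndicator k R T = 0 :=
  if_neg fun hT => hT.1.essential_of_le hT.2 h

/-- The linear form on the essential algebra sending `T` to `1` if `1 ⊆ T ⊆ R` and to `0`
otherwise. -/
noncomputable def essCoeff (R : OrderRel X) : EssentialAlgebra k X →ₗ[k] k :=
  Submodule.liftQ ((inessentialIdeal k X).restrictScalars k)
    ((Finsupp.linearCombination k (betweenIndicator k R)).comp
      (MonoidAlgebra.coeffLinearEquiv k).toLinearMap) (by
    change Submodule.span k _ ≤ _
    rw [Submodule.span_le]
    rintro _ ⟨T, hT, rfl⟩
    simp [betweenIndicator_eq_zero hT])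

variable {k}

theorem essCoeff_essClass (R : OrderRel X) (T : BinRel X) :
    essCoeff k R (essClass k T) = betweenIndicator k R T := by
  change Finsupp.linearCombination k (betweenIndicator k R)
    (MonoidAlgebra.coeffLinearEquiv k (MonoidAlgebra.of k (BinRel X) T)) = _
  simp

variable [Finite X]

/-- This is what makes the form vanish on `N`. For `σ = 1`, an order contains `S` exactly when it
contains `S̄`. For `σ ≠ 1` both sides are zero: `SΔ_σ ⊆ R` would force `Δ_σ ⊆ R`. -/
theorem betweenIndicator_mul_perm (R : OrderRel X) {S : BinRel X} (hS : S.IsReflexive)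
    (σ : Equiv.Perm X) : betweenIndicator k R (S * BinRel.perm σ) =
      betweenIndicator k R (S.transClosure * BinRel.perm σ) := by
  by_cases hσ : σ = 1
  · subst hσ
    rw [BinRel.perm_one, mul_one, mul_one]
    have : (∀ x y, S.Holds x y → R.rel.Holds x y) ↔
        ∀ x y, S.transClosure.Holds x y → R.rel.Holds x y :=
      ⟨fun h x y hxy => BinRel.transClosure_le h hxy, fun h x y hxy => h x y (.single hxy)⟩
    unfold betweenIndicator
    congr 1
    exact propext (and_congr (iff_of_true hS hS.transClosure) this)
  · have key : ∀ {T : BinRel X}, T.IsReflexive → betweenIndicator k R (T * BinRel.perm σ) = 0 := by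
      intro T hT
      refine if_neg fun h => hσ (OrderRel.perm_eq_one (R := R) fun x => h.2 _ _ ?_)
      rw [BinRel.holds_mul_perm]
      exact hT _
    rw [key hS, key hS.transClosure]

variable (k) in
/-- The linear form on the algebra of permuted orders sending `T` to `1` if `1 ⊆ T ⊆ R` and to `0`
otherwise. -/
noncomputable def unitCoeff (R : OrderRel X) : PermutedOrderAlgebra k X →ₗ[k] k :=
  Submodule.liftQ ((nilIdeal k X).restrictScalars k) (essCoeff k R) (by
    change Submodule.span k _ ≤ _
    rw [Submodule.span_le]
    rintro _ ⟨S, σ, hS, -, rfl⟩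
    change essCoeff k R _ = 0
    rw [sub_mul, map_sub, ← map_mul, ← map_mul, essCoeff_essClass, essCoeff_essClass,
      betweenIndicator_mul_perm R hS, sub_self])

theorem unitCoeff_relClass (R : OrderRel X) (T : BinRel X) :
    unitCoeff k R (relClass k T) = betweenIndicator k R T :=
  essCoeff_essClass R T

/-- Among the orders `T ≥ R` in `f_R`, only `T = R` also lies inside `R`, and `μ(R, R) = 1`; a
nontrivial `σ` is excluded since `Δ_σ T ⊆ R` would put `Δ_σ` inside `R`. -/
theorem unitCoeff_permClass_mul_fIdem [DecidableEq (Equiv.Perm X)] (R : OrderRel X)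
    (σ : Equiv.Perm X) :
    unitCoeff k R (permClass k σ * fIdem k R) = if σ = 1 then 1 else 0 := by
  have h1 : ∀ T : OrderRel X, R ≤ T → unitCoeff k R (permClass k σ * relClass k T.rel) =
      if T = R then if σ = 1 then 1 else 0 else 0 := by
    intro T hT
    change unitCoeff k R (relClass k (BinRel.perm σ) * relClass k T.rel) = _
    rw [← map_mul, unitCoeff_relClass]
    by_cases hσ : σ = 1
    · subst hσ
      rw [BinRel.perm_one, one_mul]
      simp only [betweenIndicator, T.isReflexive, true_and, ← OrderRel.le_iff, if_true]
      exact if_congr ⟨fun h => h.antisymm hT, fun h => h.le⟩ rfl rfl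
    · rw [if_neg hσ, ite_self]
      refine if_neg fun h => hσ (OrderRel.perm_eq_one (R := R) fun x => h.2 _ _ ?_)
      rw [BinRel.holds_perm_mul]
      simpa using T.refl x
  rw [fIdem, Finset.mul_sum, map_sum, Finset.sum_eq_single R]
  · rw [mul_smul_comm, map_zsmul, h1 R le_rfl, IncidenceAlgebra.mu_self, one_smul, if_pos rfl]
  · intro T hT hne
    rw [mul_smul_comm, map_zsmul, h1 T (by simpa using hT), if_neg hne, smul_zero]
  · simp

theorem permClass_mul_permClass_inv (σ : Equiv.Perm X) : permClass k σ * permClass k σ⁻¹ = 1 := by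
  rw [← map_mul, mul_inv_cancel, map_one]

theorem permClass_inv_mul_permClass (σ : Equiv.Perm X) : permClass k σ⁻¹ * permClass k σ = 1 := by
  rw [← map_mul, inv_mul_cancel, map_one]

/-- The elements `Δ_σ f_R` form a basis of `𝒫 f_R`, and `unitCoeff` computes the coordinates. -/
theorem mul_fIdem_eq_sum [Fintype (Equiv.Perm X)] (R : OrderRel X)
    (x : PermutedOrderAlgebra k X) :
    x * fIdem k R = ∑ σ : Equiv.Perm X,
      unitCoeff k R (permClass k σ⁻¹ * (x * fIdem k R)) • (permClass k σ * fIdem k R) := by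
  classical
  refine mul_fIdem_induction (p := fun y => y = ∑ σ : Equiv.Perm X,
    unitCoeff k R (permClass k σ⁻¹ * y) • (permClass k σ * fIdem k R)) x (fun τ => ?_) ?_
    (fun a b ha hb => ?_) (fun r a ha => ?_)
  · have : ∀ σ : Equiv.Perm X, unitCoeff k R (permClass k σ⁻¹ * (permClass k τ * fIdem k R)) =
        if σ = τ then 1 else 0 := by
      intro σ
      rw [← mul_assoc, ← map_mul, unitCoeff_permClass_mul_fIdem]
      exact if_congr inv_mul_eq_one rfl rfl
    simp [this, ite_smul]
  · simp
  · simp only [mul_add, map_add, add_smul, Finset.sum_add_distrib]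
    rw [← ha, ← hb]
  · simp only [mul_smul_comm, map_smul, smul_assoc, ← Finset.smul_sum]
    rw [← ha]

end Coefficient

/-! ### The matrix representations and the product decomposition of the algebra. -/

section LeftMulMatrix

variable {k : Type u} [CommRing k] {X : Type v} [Finite X]

theorem stabMap_of (R : OrderRel X) (h : R.stab) :
    stabMap k R (MonoidAlgebra.of k R.stab h) = permClass k (h : Equiv.Perm X) := by
  simp [stabMap]

theorem permClass_mul_fIdem_mul_stabMap_of (R : OrderRel X) (σ : Equiv.Perm X) (h : R.stab) :
    permClass k σ * fIdem k R * stabMap k R (MonoidAlgebra.of k R.stab h) =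
      permClass k (σ * (h : Equiv.Perm X)) * fIdem k R := by
  rw [mul_assoc, ← stabMap_mul_fIdem, stabMap_of, ← mul_assoc, ← map_mul]

noncomputable instance (R : OrderRel X) : Fintype R.stab := Fintype.ofFinite _

/-- A permutation is uniquely the product of a coset representative and of an element of the
stabilizer. -/
noncomputable def cosetEquiv {R : OrderRel X} {s : Equiv.Perm X ⧸ R.stab → Equiv.Perm X}
    (hs : ∀ j, (QuotientGroup.mk (s j) : Equiv.Perm X ⧸ R.stab) = j) :
    (Equiv.Perm X ⧸ R.stab) × R.stab ≃ Equiv.Perm X where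
  toFun p := s p.1 * p.2
  invFun σ := (QuotientGroup.mk σ, ⟨(s (QuotientGroup.mk σ))⁻¹ * σ, QuotientGroup.eq.1 (hs _)⟩)
  left_inv p := by
    have h : (QuotientGroup.mk (s p.1 * p.2) : Equiv.Perm X ⧸ R.stab) = p.1 := by
      rw [QuotientGroup.mk_mul_of_mem _ p.2.2, hs]
    ext1
    · exact h
    · ext1
      simp [h]
  right_inv σ := by simp

/-- The coordinates on the right `kΣ_R`-module `𝒫 f_R` with respect to the elements
`Δ_σ f_R`, where `σ` runs over the coset representatives `s`. -/
noncomputable def leftIdealCoord (R : OrderRel X) (s : Equiv.Perm X ⧸ R.stab → Equiv.Perm X)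
    (i : Equiv.Perm X ⧸ R.stab) : PermutedOrderAlgebra k X →ₗ[k] MonoidAlgebra k R.stab :=
  ∑ h : R.stab, (LinearMap.toSpanSingleton k _ (MonoidAlgebra.of k R.stab h)).comp
    ((unitCoeff k R).comp (LinearMap.mulLeft k (permClass k (s i * (h : Equiv.Perm X))⁻¹)))

theorem leftIdealCoord_apply (R : OrderRel X) (s : Equiv.Perm X ⧸ R.stab → Equiv.Perm X)
    (i : Equiv.Perm X ⧸ R.stab) (x : PermutedOrderAlgebra k X) :
    leftIdealCoord R s i x = ∑ h : R.stab,
      unitCoeff k R (permClass k (s i * (h : Equiv.Perm X))⁻¹ * x) •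
        MonoidAlgebra.of k R.stab h := by
  simp only [leftIdealCoord, LinearMap.sum_apply, LinearMap.comp_apply,
    LinearMap.toSpanSingleton_apply, LinearMap.mulLeft_apply]

variable {R : OrderRel X} {s : Equiv.Perm X ⧸ R.stab → Equiv.Perm X}

theorem mul_fIdem_eq_sum_leftIdealCoord
    (hs : ∀ j, (QuotientGroup.mk (s j) : Equiv.Perm X ⧸ R.stab) = j)
    (x : PermutedOrderAlgebra k X) :
    x * fIdem k R = ∑ i, permClass k (s i) * fIdem k R *
      stabMap k R (leftIdealCoord R s i (x * fIdem k R)) := by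
  have : Fintype (Equiv.Perm X) := Fintype.ofFinite _
  conv_lhs => rw [mul_fIdem_eq_sum R x, ← (cosetEquiv hs).sum_comp, Fintype.sum_prod_type]
  refine Finset.sum_congr rfl fun i _ => ?_
  rw [leftIdealCoord_apply, map_sum, Finset.mul_sum]
  refine Finset.sum_congr rfl fun h _ => ?_
  rw [map_smul, mul_smul_comm, permClass_mul_fIdem_mul_stabMap_of]
  rfl

/-- Together with the expansion `mul_fIdem_eq_sum_leftIdealCoord`, this says that `𝒫 f_R` is free
over `kΣ_R` on the coset representatives: the coordinate functions are dual to them. -/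
theorem leftIdealCoord_permClass_mul
    (hs : ∀ j, (QuotientGroup.mk (s j) : Equiv.Perm X ⧸ R.stab) = j)
    (i j : Equiv.Perm X ⧸ R.stab) (a : MonoidAlgebra k R.stab) :
    leftIdealCoord R s i (permClass k (s j) * fIdem k R * stabMap k R a) =
      if i = j then a else 0 := by
  classical
  induction a using MonoidAlgebra.induction_on with
  | of g =>
    rw [permClass_mul_fIdem_mul_stabMap_of, leftIdealCoord_apply]
    have key : ∀ h : R.stab, (s i * (h : Equiv.Perm X))⁻¹ * (s j * (g : Equiv.Perm X)) = 1 ↔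
        i = j ∧ h = g := by
      intro h
      rw [inv_mul_eq_one]
      change cosetEquiv hs (i, h) = cosetEquiv hs (j, g) ↔ _
      rw [EmbeddingLike.apply_eq_iff_eq, Prod.mk.injEq]
    simp only [← mul_assoc (permClass k _) (permClass k _), ← map_mul,
      unitCoeff_permClass_mul_fIdem, key]
    by_cases hij : i = j <;> simp [hij, ite_smul]
  | add a b ha hb =>
    rw [map_add, mul_add, map_add, ha, hb]
    split_ifs <;> simp
  | smul r a ha =>
    rw [map_smul, mul_smul_comm, map_smul, ha]
    split_ifs <;> simp

theorem leftIdealCoord_sum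
    (hs : ∀ j, (QuotientGroup.mk (s j) : Equiv.Perm X ⧸ R.stab) = j)
    (a : Equiv.Perm X ⧸ R.stab → MonoidAlgebra k R.stab)
    (i : Equiv.Perm X ⧸ R.stab) :
    leftIdealCoord R s i (∑ j, permClass k (s j) * fIdem k R * stabMap k R (a j)) = a i := by
  simp [map_sum, leftIdealCoord_permClass_mul hs]

theorem mul_permClass_mul_fIdem
    (hs : ∀ j, (QuotientGroup.mk (s j) : Equiv.Perm X ⧸ R.stab) = j)
    (x : PermutedOrderAlgebra k X) (j : Equiv.Perm X ⧸ R.stab) :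
    x * (permClass k (s j) * fIdem k R) = ∑ i, permClass k (s i) * fIdem k R *
      stabMap k R (leftIdealCoord R s i (x * (permClass k (s j) * fIdem k R))) := by
  rw [← mul_assoc]
  exact mul_fIdem_eq_sum_leftIdealCoord hs _

/-- The matrix representation of left multiplication on the right `kΣ_R`-module `𝒫 f_R`. -/
noncomputable def leftMulMatrix
    (hs : ∀ j, (QuotientGroup.mk (s j) : Equiv.Perm X ⧸ R.stab) = j) :
    PermutedOrderAlgebra k X →ₐ[k]
    Matrix (Equiv.Perm X ⧸ R.stab) (Equiv.Perm X ⧸ R.stab) (MonoidAlgebra k R.stab) :=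
  AlgHom.ofLinearMap
    { toFun := fun x => Matrix.of fun i j =>
        leftIdealCoord R s i (x * (permClass k (s j) * fIdem k R))
      map_add' := fun x y => by ext1 i j; simp [add_mul]
      map_smul' := fun r x => by ext1 i j; simp }
    (by
      ext1 i j
      change leftIdealCoord R s i (1 * (permClass k (s j) * fIdem k R)) = _
      have := leftIdealCoord_permClass_mul hs i j (1 : MonoidAlgebra k R.stab)
      rw [map_one, mul_one] at this
      rw [one_mul, this, Matrix.one_apply])
    (fun x y => by
      ext1 i j
      change leftIdealCoord R s i (x * y * (permClass k (s j) * fIdem k R)) =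
        ∑ l, leftIdealCoord R s i (x * (permClass k (s l) * fIdem k R)) *
          leftIdealCoord R s l (y * (permClass k (s j) * fIdem k R))
      -- Writing the matrix entry as a coordinate of the corresponding sum reduces multiplicativity
      -- to an identity in `𝒫 f_R`, obtained by expanding the action of `y` and then that of `x`.
      rw [← leftIdealCoord_sum hs (fun i => ∑ l,
        leftIdealCoord R s i (x * (permClass k (s l) * fIdem k R)) *
          leftIdealCoord R s l (y * (permClass k (s j) * fIdem k R))) i]
      congr 1
      simp only [map_sum, map_mul, Finset.mul_sum, ← mul_assoc (_ * fIdem k R)]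
      rw [Finset.sum_comm]
      simp only [← Finset.sum_mul]
      simp only [← mul_permClass_mul_fIdem hs]
      conv_lhs => rw [mul_assoc, mul_permClass_mul_fIdem hs y j, Finset.mul_sum]
      simp only [mul_assoc])

theorem isLeftMulMatrix_leftMulMatrix {k : Type u} [Field k]
    (hs : ∀ j, (QuotientGroup.mk (s j) : Equiv.Perm X ⧸ R.stab) = j) :
    IsLeftMulMatrix (k := k) R s (leftMulMatrix hs) :=
  mul_permClass_mul_fIdem hs

theorem permClass_mul_fIdem_conj {R S : OrderRel X} {σ : Equiv.Perm X} (h : σ • R = S) :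
    permClass k σ * fIdem k R * permClass k σ⁻¹ = fIdem k S := by
  rw [permClass_mul_fIdem, h, mul_assoc, permClass_mul_permClass_inv, mul_one]

/-- The element of `𝒫` acting on `𝒫 f_R` as an elementary matrix. -/
noncomputable def matrixUnitLift (R : OrderRel X) (s : Equiv.Perm X ⧸ R.stab → Equiv.Perm X)
    (i j : Equiv.Perm X ⧸ R.stab) (a : MonoidAlgebra k R.stab) : PermutedOrderAlgebra k X :=
  permClass k (s i) * fIdem k R * stabMap k R a * permClass k (s j)⁻¹

/-- As `f_R` is idempotent and commutes with `kΣ_R`, a second copy of it can be placed to the right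
of `a`; orthogonality of the idempotents then decides whether the product survives. -/
theorem matrixUnitLift_mul {R S : OrderRel X} (s : Equiv.Perm X ⧸ R.stab → Equiv.Perm X)
    (i j : Equiv.Perm X ⧸ R.stab) (a : MonoidAlgebra k R.stab) (σ : Equiv.Perm X) :
    matrixUnitLift R s i j a * (permClass k σ * fIdem k S) =
      if R = ((s j)⁻¹ * σ) • S then
        permClass k (s i) * fIdem k R * stabMap k R a * (permClass k ((s j)⁻¹ * σ) * fIdem k S)
      else 0 := by
  have h1 : fIdem k R * stabMap k R a = fIdem k R * stabMap k R a * fIdem k R := by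
    rw [mul_assoc, stabMap_mul_fIdem, ← mul_assoc, fIdem_mul_self]
  have h2 : matrixUnitLift R s i j a * (permClass k σ * fIdem k S) =
      permClass k (s i) * (fIdem k R * stabMap k R a) *
        (permClass k ((s j)⁻¹ * σ) * fIdem k S) := by
    simp only [matrixUnitLift, map_mul, mul_assoc]
  rw [h2, h1, mul_assoc, mul_assoc _ (fIdem k R), fIdem_mul_permClass_mul_fIdem]
  split_ifs
  · simp only [mul_assoc]
  · rw [mul_zero, mul_zero]

theorem leftMulMatrix_eq
    (hs : ∀ j, (QuotientGroup.mk (s j) : Equiv.Perm X ⧸ R.stab) = j)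
    {x : PermutedOrderAlgebra k X}
    {A : Matrix (Equiv.Perm X ⧸ R.stab) (Equiv.Perm X ⧸ R.stab) (MonoidAlgebra k R.stab)}
    (h : ∀ j, x * (permClass k (s j) * fIdem k R) =
      ∑ i, permClass k (s i) * fIdem k R * stabMap k R (A i j)) : leftMulMatrix hs x = A := by
  ext1 i j
  change leftIdealCoord R s i (x * (permClass k (s j) * fIdem k R)) = _
  rw [h, leftIdealCoord_sum hs]

theorem leftMulMatrix_matrixUnitLift
    (hs : ∀ j, (QuotientGroup.mk (s j) : Equiv.Perm X ⧸ R.stab) = j)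
    (i j : Equiv.Perm X ⧸ R.stab) (a : MonoidAlgebra k R.stab) :
    leftMulMatrix hs (matrixUnitLift R s i j a) = Matrix.single i j a := by
  refine leftMulMatrix_eq hs fun l => ?_
  -- Orthogonality only detects cosets: `(s j)⁻¹ * s l` fixes `R` exactly when the cosets agree.
  have h : R = ((s j)⁻¹ * s l) • R ↔ j = l := by
    rw [eq_comm, ← MulAction.mem_stabilizer_iff, ← QuotientGroup.eq, hs, hs]
  rw [matrixUnitLift_mul]
  by_cases hjl : j = l
  · subst hjl
    rw [if_pos (h.2 rfl), Finset.sum_eq_single i]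
    · rw [Matrix.single_apply_same, inv_mul_cancel, map_one, one_mul, mul_assoc,
        stabMap_mul_fIdem, mul_assoc _ (fIdem k R), ← mul_assoc (fIdem k R), fIdem_mul_self,
        ← mul_assoc]
    · intro i' _ hi'
      rw [Matrix.single_apply_of_ne _ _ _ _ _ (fun h => hi' h.1.symm), map_zero, mul_zero]
    · simp
  · rw [if_neg (fun h' => hjl (h.1 h')), Finset.sum_eq_zero]
    intro i' _
    rw [Matrix.single_apply_of_ne _ _ _ _ _ (fun h => hjl h.2), map_zero, mul_zero]

theorem leftMulMatrix_matrixUnitLift_of_ne {S : OrderRel X}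
    {t : Equiv.Perm X ⧸ S.stab → Equiv.Perm X}
    (ht : ∀ j, (QuotientGroup.mk (t j) : Equiv.Perm X ⧸ S.stab) = j)
    (hRS : ∀ σ : Equiv.Perm X, R ≠ σ • S)
    (i j : Equiv.Perm X ⧸ R.stab) (a : MonoidAlgebra k R.stab) :
    leftMulMatrix ht (matrixUnitLift R s i j a) = 0 := by
  refine leftMulMatrix_eq ht fun l => ?_
  rw [matrixUnitLift_mul, if_neg (hRS _)]
  simp

/-- Injectivity: `x` is the sum of the `x f_S`, and each `f_S` is a conjugate of the idempotent of
its orbit representative, so the matrices determine `x`. Surjectivity: matrix units lift, and a lift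
for one orbit acts by zero on the blocks of the others. -/
theorem bijective_leftMulMatrix {s : (R : OrderRel X) → Equiv.Perm X ⧸ R.stab → Equiv.Perm X}
    (hs : ∀ R j, (QuotientGroup.mk (s R j) : Equiv.Perm X ⧸ R.stab) = j)
    {r : MulAction.orbitRel.Quotient (Equiv.Perm X) (OrderRel X) → OrderRel X}
    (hr : ∀ o, Quotient.mk (MulAction.orbitRel (Equiv.Perm X) (OrderRel X)) (r o) = o) :
    Function.Bijective (fun (x : PermutedOrderAlgebra k X) o => leftMulMatrix (hs (r o)) x) := by
  have orbit : ∀ S : OrderRel X, ∀ o, Quotient.mk _ S = o → ∃ σ : Equiv.Perm X, σ • r o = S := by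
    intro S o h
    rw [← hr o] at h
    exact Quotient.exact h
  constructor
  · intro x y hxy
    rw [← mul_one x, ← mul_one y, ← sum_fIdem, Finset.mul_sum, Finset.mul_sum]
    refine Finset.sum_congr rfl fun S _ => ?_
    obtain ⟨σ, hσ⟩ := orbit S _ rfl
    set o := Quotient.mk (MulAction.orbitRel (Equiv.Perm X) (OrderRel X)) S
    -- The matrices describe the action on `Δ_τ f` only for chosen representatives `τ`, so `σ` is
    -- replaced by the representative of its coset, which carries `r o` to the same `S`.
    set τ := s (r o) (QuotientGroup.mk σ) with hτ
    have hmem : σ⁻¹ * τ ∈ (r o).stab := QuotientGroup.eq.1 (hs (r o) _).symm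
    have hτS : τ • r o = S := by
      rw [← hσ, ← mul_inv_cancel_left σ τ, mul_smul, MulAction.mem_stabilizer_iff.1 hmem]
    have h1 := congrFun hxy o
    have h2 : x * (permClass k τ * fIdem k (r o)) = y * (permClass k τ * fIdem k (r o)) := by
      rw [hτ, mul_permClass_mul_fIdem (hs (r o)) x, mul_permClass_mul_fIdem (hs (r o)) y]
      refine Finset.sum_congr rfl fun i _ => ?_
      congr 2
      exact congrFun (congrFun h1 i) _
    rw [← permClass_mul_fIdem_conj (k := k) hτS, ← mul_assoc x, ← mul_assoc y, h2]
  · intro A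
    have : Fintype (MulAction.orbitRel.Quotient (Equiv.Perm X) (OrderRel X)) := Fintype.ofFinite _
    refine ⟨∑ o, ∑ i, ∑ j, matrixUnitLift (r o) (s (r o)) i j (A o i j), ?_⟩
    funext o
    change leftMulMatrix (hs (r o)) _ = _
    rw [map_sum, Finset.sum_eq_single o]
    · simp only [map_sum, leftMulMatrix_matrixUnitLift]
      exact (Matrix.matrix_eq_sum_single _).symm
    · intro o' _ hne
      simp only [map_sum]
      refine Finset.sum_eq_zero fun i _ => Finset.sum_eq_zero fun j _ =>
        leftMulMatrix_matrixUnitLift_of_ne _ (fun σ h => hne ?_) _ _ _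
      rw [← hr o', ← hr o]
      exact Quotient.sound ⟨σ, h.symm⟩
    · simp

end LeftMulMatrix

/-! ### Simple modules and their corners, for a general idempotent. -/

section Corners

variable {A B : Type*} [Ring A] [Ring B]

/-- Given a ring homomorphism `g : B → A` and an element `e` of `A`, the map `ι` identifies the
`B`-module `V` with the part of the `A`-module `M` fixed by `e`. -/
structure IsModuleCorner (g : B →+* A) (e : A) {V M : Type*} [AddCommGroup V] [Module B V]
    [AddCommGroup M] [Module A M] (ι : V →+ M) : Prop where
  injective : Function.Injective ι
  map_smul : ∀ b v, ι (b • v) = g b • ι v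
  smul_apply : ∀ v, e • ι v = ι v
  exists_eq : ∀ m, e • m = m → ∃ v, ι v = m

/-- The elements of `e A e` come from `B`. -/
structure IsCornerMap (g : B →+* A) (e : A) : Prop where
  idem : e * e = e
  comm : ∀ b, g b * e = e * g b
  exists_eq : ∀ a, ∃ b, e * a * e = e * g b

variable {g : B →+* A} {e : A} {V V' M M' : Type*} [AddCommGroup V] [Module B V]
  [AddCommGroup V'] [Module B V'] [AddCommGroup M] [Module A M] [AddCommGroup M'] [Module A M']
  {ι : V →+ M} {ι' : V →+ M'}

theorem IsModuleCorner.exists_eq_smul (h : IsModuleCorner g e ι) (hg : IsCornerMap g e) (m : M) :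
    ∃ v, ι v = e • m :=
  h.exists_eq _ (by rw [smul_smul, hg.idem])

/-- Compressing the action of `a` to the part fixed by `e` gives the action of an element of `B`;
every later transfer between `A` and `B` uses this. -/
theorem IsModuleCorner.smul_smul_apply (h : IsModuleCorner g e ι) (hg : IsCornerMap g e) {a : A}
    {b : B} (hb : e * a * e = e * g b) (v : V) : e • a • ι v = ι (b • v) := by
  rw [h.map_smul, ← h.smul_apply v, smul_smul, smul_smul, hb, ← hg.comm, mul_smul,
    h.smul_apply]

theorem IsSimpleModule.exists_smul_eq [IsSimpleModule A M] {m : M} (hm : m ≠ 0) (m' : M) :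
    ∃ a : A, a • m = m' :=
  IsSimpleModule.toSpanSingleton_surjective A hm m'

theorem isSimpleModule_of_exists_smul_eq [Nontrivial M]
    (h : ∀ m : M, m ≠ 0 → ∀ m', ∃ a : A, a • m = m') : IsSimpleModule A M :=
  isSimpleModule_iff_toSpanSingleton_surjective.2 ⟨inferInstance, h⟩

theorem IsModuleCorner.isSimpleModule (h : IsModuleCorner g e ι) (hg : IsCornerMap g e)
    [IsSimpleModule A M] [Nontrivial V] : IsSimpleModule B V := by
  refine isSimpleModule_of_exists_smul_eq fun u hu v => ?_
  have hu' : ι u ≠ 0 := fun h0 => hu (h.injective (h0.trans ι.map_zero.symm))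
  obtain ⟨a, ha⟩ := IsSimpleModule.exists_smul_eq (A := A) hu' (ι v)
  obtain ⟨b, hb⟩ := hg.exists_eq a
  refine ⟨b, h.injective ?_⟩
  rw [← h.smul_smul_apply hg hb, ha, h.smul_apply]

/-- A nonzero `m` has a multiple with nonzero compression to the corner; by simplicity of `V` that
element reaches the whole corner, which generates `M`. -/
theorem IsModuleCorner.isSimpleModule_of_generates (h : IsModuleCorner g e ι) (hg : IsCornerMap g e)
    [IsSimpleModule B V] (hspan : Submodule.span A (Set.range ι) = ⊤)
    (hne : ∀ m : M, m ≠ 0 → ∃ a : A, e • a • m ≠ 0) : IsSimpleModule A M := by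
  have : Nontrivial V := IsSimpleModule.nontrivial B V
  have : Nontrivial M := h.injective.nontrivial
  refine isSimpleModule_of_exists_smul_eq fun m hm m' => ?_
  rw [← Submodule.mem_span_singleton]
  suffices hle : Submodule.span A (Set.range ι) ≤ Submodule.span A {m} by
    rw [hspan] at hle
    exact hle trivial
  rw [Submodule.span_le]
  rintro _ ⟨v, rfl⟩
  obtain ⟨a, ha⟩ := hne m hm
  obtain ⟨u, hu⟩ := h.exists_eq_smul hg (a • m)
  have hu0 : u ≠ 0 := by
    rintro rfl
    exact ha (hu.symm.trans ι.map_zero)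
  obtain ⟨b, rfl⟩ := IsSimpleModule.exists_smul_eq (A := B) hu0 v
  refine Submodule.mem_span_singleton.2 ⟨g b * (e * a), ?_⟩
  rw [h.map_smul, hu, mul_smul, mul_smul]

/-- Simple modules with isomorphic nonzero corners are isomorphic. -/
theorem IsModuleCorner.nonempty_linearEquiv (h : IsModuleCorner g e ι) (h' : IsModuleCorner g e ι')
    (hg : IsCornerMap g e) [Nontrivial V] [IsSimpleModule A M] [IsSimpleModule A M'] :
    Nonempty (M ≃ₗ[A] M') := by
  -- The isomorphism is built from its graph, generated by the pairs that it must match on the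
  -- corners.
  let Γ : Submodule A (M × M') := Submodule.span A (Set.range fun v => (ι v, ι' v))
  -- Compression never breaks a matched pair. Hence `Γ` has no element `(0, m')` with `m' ≠ 0`:
  -- moving `m'` to `ι' v₀` would match `ι' v₀` with `0`.
  have key : ∀ p ∈ Γ, ∀ a : A, ∃ v, e • a • p.1 = ι v ∧ e • a • p.2 = ι' v := by
    intro p hp
    induction hp using Submodule.span_induction with
    | mem p hp =>
      obtain ⟨v, rfl⟩ := hp
      intro a
      obtain ⟨b, hb⟩ := hg.exists_eq a
      exact ⟨b • v, h.smul_smul_apply hg hb v, h'.smul_smul_apply hg hb v⟩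
    | zero => exact fun a => ⟨0, by simp, by simp⟩
    | add p q _ _ hp hq =>
      intro a
      obtain ⟨v, h1, h2⟩ := hp a
      obtain ⟨w, h3, h4⟩ := hq a
      exact ⟨v + w, by simp [h1, h3], by simp [h2, h4]⟩
    | smul c p _ hp =>
      intro a
      obtain ⟨v, h1, h2⟩ := hp (a * c)
      exact ⟨v, by simpa [mul_smul] using h1, by simpa [mul_smul] using h2⟩
  obtain ⟨v₀, hv₀⟩ := exists_ne (0 : V)
  have hι : ι v₀ ≠ 0 := fun h0 => hv₀ (h.injective (h0.trans ι.map_zero.symm))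
  have hι' : ι' v₀ ≠ 0 := fun h0 => hv₀ (h'.injective (h0.trans ι'.map_zero.symm))
  have hmem : ∀ v, (ι v, ι' v) ∈ Γ := fun v => Submodule.subset_span ⟨v, rfl⟩
  let p : Γ →ₗ[A] M := (LinearMap.fst A M M').comp Γ.subtype
  let q : Γ →ₗ[A] M' := (LinearMap.snd A M M').comp Γ.subtype
  have hp : Function.Bijective p := by
    constructor
    · refine (injective_iff_map_eq_zero p).2 ?_
      rintro ⟨⟨m, m'⟩, hm⟩ (rfl : m = 0)
      by_contra hne
      have hm' : m' ≠ 0 := by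
        rintro rfl
        exact hne rfl
      obtain ⟨a, ha⟩ := IsSimpleModule.exists_smul_eq (A := A) hm' (ι' v₀)
      obtain ⟨v, h1, h2⟩ := key _ hm a
      rw [smul_zero, smul_zero, eq_comm, map_eq_zero_iff ι h.injective] at h1
      rw [ha, h'.smul_apply, h1, map_zero] at h2
      exact hι' h2
    · intro m
      obtain ⟨a, ha⟩ := IsSimpleModule.exists_smul_eq (A := A) hι m
      exact ⟨⟨_, Γ.smul_mem a (hmem v₀)⟩, ha⟩
  let f : M →ₗ[A] M' := q.comp (LinearEquiv.ofBijective p hp).symm.toLinearMap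
  have hf : f (ι v₀) = ι' v₀ := by
    have : (LinearEquiv.ofBijective p hp).symm (ι v₀) = ⟨_, hmem v₀⟩ := by
      rw [LinearEquiv.symm_apply_eq]
      rfl
    change q _ = _
    erw [this]
    rfl
  refine ⟨LinearEquiv.ofBijective f (LinearMap.bijective_of_ne_zero fun h0 => hι' ?_)⟩
  rw [← hf, h0, LinearMap.zero_apply]

/-- Two corners of the same module are isomorphic. -/
theorem IsModuleCorner.nonempty_linearEquiv_corner {ι : V →+ M} {κ : V' →+ M}
    (h : IsModuleCorner g e ι)
    (h' : IsModuleCorner g e κ) : Nonempty (V ≃ₗ[B] V') := by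
  have hex : ∀ v, ∃ v', κ v' = ι v := fun v => h'.exists_eq _ (h.smul_apply v)
  choose f hf using hex
  refine ⟨LinearEquiv.ofBijective { toFun := f, map_add' := ?_, map_smul' := ?_ } ⟨?_, ?_⟩⟩
  · intro x y
    apply h'.injective
    simp [hf]
  · intro b x
    apply h'.injective
    rw [hf, h.map_smul, RingHom.id_apply, h'.map_smul, hf]
  · intro x y hxy
    apply h.injective
    rw [← hf, ← hf]
    exact congrArg κ hxy
  · intro v'
    obtain ⟨v, hv⟩ := h.exists_eq _ (h'.smul_apply v')
    exact ⟨v, h'.injective ((hf v).trans hv)⟩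

theorem IsModuleCorner.comp_linearEquiv {ι : V →+ M} (h : IsModuleCorner g e ι) (φ : V' ≃ₗ[B] V)
    (ψ : M ≃ₗ[A] M') :
    IsModuleCorner g e
      ((ψ.toLinearMap.toAddMonoidHom.comp ι).comp φ.toLinearMap.toAddMonoidHom) where
  injective := ψ.injective.comp (h.injective.comp φ.injective)
  map_smul b v := by
    change ψ (ι (φ (b • v))) = g b • ψ (ι (φ v))
    rw [φ.map_smul, h.map_smul, ψ.map_smul]
  smul_apply v := by
    change e • ψ (ι (φ v)) = ψ (ι (φ v))
    rw [← ψ.map_smul, h.smul_apply]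
  exists_eq m hm := by
    obtain ⟨v, hv⟩ := h.exists_eq (ψ.symm m) (by rw [← ψ.symm.map_smul, hm])
    refine ⟨φ.symm v, ?_⟩
    change ψ (ι (φ (φ.symm v))) = m
    rw [φ.apply_symm_apply, hv, ψ.apply_symm_apply]

/-- The part of `M` fixed by `e`. -/
def fixedPart (e : A) (M : Type*) [AddCommGroup M] [Module A M] : AddSubgroup M where
  carrier := {m | e • m = m}
  zero_mem' := smul_zero e
  add_mem' := fun {a b} (ha : e • a = a) (hb : e • b = b) => by
    change e • (a + b) = a + b
    rw [smul_add, ha, hb]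
  neg_mem' := fun {a} (ha : e • a = a) => by
    change e • (-a) = -a
    rw [smul_neg, ha]

/-- The `B`-module structure on the part of `M` fixed by `e`. -/
abbrev fixedPartModule (hg : IsCornerMap g e) : Module B (fixedPart e M) where
  smul b m := ⟨g b • m.1, by
    change e • g b • m.1 = g b • m.1
    rw [smul_smul, ← hg.comm, mul_smul]
    congr 1
    exact m.2⟩
  one_smul m := Subtype.ext (by
    change g 1 • m.1 = m.1
    rw [map_one, one_smul])
  mul_smul a b m := Subtype.ext (by
    change g (a * b) • m.1 = g a • g b • m.1
    rw [map_mul, mul_smul])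
  smul_zero b := Subtype.ext (smul_zero (g b))
  smul_add b m n := Subtype.ext (smul_add (g b) m.1 n.1)
  add_smul a b m := Subtype.ext (by
    change g (a + b) • m.1 = g a • m.1 + g b • m.1
    rw [map_add, add_smul])
  zero_smul m := Subtype.ext (by
    change g 0 • m.1 = 0
    rw [map_zero, zero_smul])

theorem isModuleCorner_fixedPart (hg : IsCornerMap g e) :
    @IsModuleCorner A B _ _ g e (fixedPart e M) M _ (fixedPartModule hg) _ _
      (fixedPart e M).subtype :=
  letI := fixedPartModule (M := M) hg
  { injective := Subtype.val_injective
    map_smul := fun _ _ => rfl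
    smul_apply := fun v => v.2
    exists_eq := fun m hm => ⟨⟨m, hm⟩, rfl⟩ }

end Corners

/-! ### The corners of the algebra of permuted orders. -/

section OrderCorners

variable {k : Type u} [CommRing k] {X : Type v} [Finite X]

theorem fIdem_mul_mul_fIdem_eq_zero {R S : OrderRel X} (h : ∀ σ : Equiv.Perm X, R ≠ σ • S)
    (x : PermutedOrderAlgebra k X) : fIdem k R * (x * fIdem k S) = 0 := by
  refine mul_fIdem_induction (p := fun y => fIdem k R * y = 0) x (fun σ => ?_) (mul_zero _)
    (fun a b ha hb => ?_) (fun r a ha => ?_)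
  · rw [fIdem_mul_permClass_mul_fIdem, if_neg (h σ)]
  · rw [mul_add, ha, hb, add_zero]
  · rw [mul_smul_comm, ha, smul_zero]

/-- The corner `f_R 𝒫 f_R` is spanned by the `f_R Δ_σ f_R`, which vanish by orthogonality unless `σ`
stabilizes `R`. -/
theorem isCornerMap (R : OrderRel X) : IsCornerMap (stabMap k R).toRingHom (fIdem k R) where
  idem := fIdem_mul_self R
  comm := stabMap_mul_fIdem k R
  exists_eq x := by
    rw [mul_assoc]
    refine mul_fIdem_induction (p := fun y => ∃ b, fIdem k R * y = fIdem k R * stabMap k R b) x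
      (fun σ => ?_) ⟨0, by simp⟩ ?_ ?_
    · rw [fIdem_mul_permClass_mul_fIdem]
      split_ifs with h
      · refine ⟨MonoidAlgebra.of k _ ⟨σ, h.symm⟩, ?_⟩
        rw [← stabMap_mul_fIdem, stabMap_of]
      · exact ⟨0, by simp⟩
    · rintro a b ⟨c, hc⟩ ⟨d, hd⟩
      exact ⟨c + d, by rw [mul_add, hc, hd, map_add, mul_add]⟩
    · rintro r a ⟨c, hc⟩
      exact ⟨r • c, by rw [mul_smul_comm, hc, map_smul, mul_smul_comm]⟩

/-- The `kΣ_R`-module `V` is isomorphic to the part of the `𝒫`-module `M` fixed by `f_R`. -/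
def HasCorner (k : Type u) [CommRing k] {X : Type v} [Finite X] (R : OrderRel X)
    (V : Type*) [AddCommGroup V] [Module (MonoidAlgebra k R.stab) V]
    (M : Type*) [AddCommGroup M] [Module (PermutedOrderAlgebra k X) M] : Prop :=
  ∃ ι : V →+ M, IsModuleCorner (stabMap k R).toRingHom (fIdem k R) ι

end OrderCorners

/-! ### Simple modules over a matrix algebra over a field. -/

section MatrixModules

open scoped Matrix.Module

variable {k n : Type*} [Field k] [Fintype n] [DecidableEq n]

theorem isSimpleModule_matrix_pi [Nonempty n] : IsSimpleModule (Matrix n n k) (n → k) := by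
  refine isSimpleModule_of_exists_smul_eq fun c hc d => ?_
  obtain ⟨i, hi⟩ := Function.ne_iff.1 hc
  -- Only column `i` is nonzero, so the matrix reads off the coordinate `c i` and scales it to `d`.
  refine ⟨Matrix.of fun a b => if b = i then d a * (c i)⁻¹ else 0, ?_⟩
  ext a
  have hi' : c i ≠ 0 := hi
  simp [Matrix.Module.smul_apply, ite_mul, hi']

variable {W : Type*} [AddCommGroup W] [Module (Matrix n n k) W]

theorem sum_single_smul (w : W) : ∑ i, (Matrix.single i i 1 : Matrix n n k) • w = w := by
  rw [← Finset.sum_smul, Matrix.sum_single_one, one_smul]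

/-- The diagonal units sum to `1`, so some `E_jj w` is nonzero; then `E_ij w` is fixed by `E_ii`,
and it is nonzero because `E_ji` sends it back to `E_jj w`. -/
theorem exists_single_smul_eq [IsSimpleModule (Matrix n n k) W] (i : n) :
    ∃ w : W, w ≠ 0 ∧ (Matrix.single i i 1 : Matrix n n k) • w = w := by
  have : Nontrivial W := IsSimpleModule.nontrivial (Matrix n n k) W
  obtain ⟨w, hw⟩ := exists_ne (0 : W)
  obtain ⟨j, hj⟩ : ∃ j, (Matrix.single j j 1 : Matrix n n k) • w ≠ 0 := by
    by_contra! h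
    exact hw ((sum_single_smul w).symm.trans (Finset.sum_eq_zero fun j _ => h j))
  refine ⟨(Matrix.single i j 1 : Matrix n n k) • w, fun h => hj ?_, ?_⟩
  · have : (Matrix.single j i 1 : Matrix n n k) • (Matrix.single i j 1 : Matrix n n k) • w = 0 := by
      rw [h, smul_zero]
    rwa [smul_smul, Matrix.single_mul_single_same, one_mul] at this
  · rw [smul_smul, Matrix.single_mul_single_same, one_mul]

/-- A simple module over a matrix algebra over a field is isomorphic to the standard one. -/
theorem nonempty_pi_linearEquiv [IsSimpleModule (Matrix n n k) W] [Nonempty n] :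
    Nonempty ((n → k) ≃ₗ[Matrix n n k] W) := by
  have : IsSimpleModule (Matrix n n k) (n → k) := isSimpleModule_matrix_pi
  obtain ⟨j⟩ := ‹Nonempty n›
  obtain ⟨w, hw, hj⟩ := exists_single_smul_eq (k := k) (W := W) j
  -- A column vector is placed in column `j` and applied to `w`, a vector fixed by `E_jj`; the basis
  -- vector at `j` thus goes to `w ≠ 0`, and Schur's lemma applies.
  let f : (n → k) →ₗ[Matrix n n k] W :=
    { toFun := fun c => (Matrix.of fun a b => if b = j then c a else 0 : Matrix n n k) • w
      map_add' := fun c d => by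
        rw [← add_smul]
        congr 1
        ext a b
        simp only [Matrix.of_apply, Matrix.add_apply, Pi.add_apply]
        split_ifs <;> simp
      map_smul' := fun T c => by
        rw [RingHom.id_apply, smul_smul]
        congr 1
        ext a b
        rw [Matrix.mul_apply, Matrix.of_apply, Matrix.Module.smul_apply]
        simp only [Matrix.of_apply, smul_eq_mul]
        split_ifs
        · rfl
        · simp }
  refine ⟨LinearEquiv.ofBijective f (LinearMap.bijective_of_ne_zero fun h0 => hw ?_)⟩
  rw [← hj]
  have : (Matrix.of fun a b => if b = j then (Pi.single j 1 : n → k) a else 0 : Matrix n n k) =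
      Matrix.single j j 1 := by
    ext a b
    simp only [Matrix.of_apply, Matrix.single_apply, Pi.single_apply]
    grind
  rw [← this]
  exact LinearMap.congr_fun h0 (Pi.single j 1)

/-- The matrix algebra over a field has a unique simple module up to isomorphism. -/
theorem nonempty_unique_simpleIso_matrix (k : Type u) [Field k] (n : Type v) [Fintype n]
    [DecidableEq n] [Nonempty n] :
    Nonempty (Unique (SimpleIso.{max u v, max u v w} (Matrix n n k))) := by
  have h : IsSimpleModule (Matrix n n k) (n → k) := isSimpleModule_matrix_pi
  let M : SimpleMod.{max u v, max u v w} (Matrix n n k) :=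
    ⟨ModuleCat.of (Matrix n n k) (ULift.{w} (n → k)),
      (ULift.moduleEquiv (R := Matrix n n k) (M := n → k)).isSimpleModule_iff.2 h⟩
  refine ⟨⟨⟨M.cls⟩, fun x => ?_⟩⟩
  induction x using Quotient.inductionOn with
  | h N =>
    have := N.2
    obtain ⟨e⟩ := nonempty_pi_linearEquiv (k := k) (n := n) (W := N.1)
    exact Quotient.sound ⟨e.symm.trans (ULift.moduleEquiv (R := Matrix n n k) (M := n → k)).symm⟩

/-- `E_ii W` is the line through `w₀`: if `w = T w₀`, then `E_ii T E_ii = T_ii E_ii`. -/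
theorem exists_smul_of_single_smul [IsSimpleModule (Matrix n n k) W] [Module k W]
    [IsScalarTower k (Matrix n n k) W] {i : n} {w₀ : W} (hw₀ : w₀ ≠ 0)
    (hi : (Matrix.single i i 1 : Matrix n n k) • w₀ = w₀) (w : W) :
    ∃ c : k, (Matrix.single i i 1 : Matrix n n k) • w = c • w₀ := by
  obtain ⟨T, rfl⟩ := IsSimpleModule.exists_smul_eq (A := Matrix n n k) hw₀ w
  refine ⟨T i i, ?_⟩
  conv_lhs => rw [← hi]
  conv_rhs => rw [← hi]
  rw [smul_smul, smul_smul, ← smul_assoc]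
  congr 1
  rw [Matrix.single_mul_mul_single, Matrix.smul_single, one_mul, smul_eq_mul]

theorem rank_simple_matrix_module {n : Type v} [Fintype n] [DecidableEq n] [Nonempty n]
    {k : Type u} [Field k] {W : Type (max u v w)}
    [AddCommGroup W] [Module (Matrix n n k) W] [Module k W] [IsScalarTower k (Matrix n n k) W]
    [IsSimpleModule (Matrix n n k) W] : Module.rank k W = Nat.card n := by
  obtain ⟨e⟩ := nonempty_pi_linearEquiv (k := k) (n := n) (W := W)
  have := (e.restrictScalars k).lift_rank_eq
  rw [rank_fun', Cardinal.lift_natCast, Cardinal.lift_id', ← Nat.card_eq_fintype_card] at this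
  exact this.symm

theorem matrixTensorEnd_single {A V : Type*} [Ring A] [Algebra k A] [Module k W]
    [IsScalarTower k (Matrix n n k) W] [AddCommGroup V] [Module k V] [Module A V]
    [IsScalarTower k A V] (i j : n) (a : A) (w : W) (v : V) :
    matrixTensorEnd k n A W V (Matrix.single i j a) (w ⊗ₜ[k] v) =
      ((Matrix.single i j 1 : Matrix n n k) • w) ⊗ₜ[k] (a • v) := by
  have h : ((matrixEquivTensor n k A).trans (Algebra.TensorProduct.comm k A (Matrix n n k)))
      (Matrix.single i j a) = Matrix.single i j 1 ⊗ₜ a := by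
    rw [AlgEquiv.trans_apply, matrixEquivTensor_apply_single, Algebra.TensorProduct.comm_tmul]
  change Module.endTensorEndAlgHom (Algebra.TensorProduct.map (Algebra.lsmul k k W)
    (Algebra.lsmul k k V) (((matrixEquivTensor n k A).trans
      (Algebra.TensorProduct.comm k A (Matrix n n k))) (Matrix.single i j a))) (w ⊗ₜ[k] v) = _
  rw [h]
  rfl

theorem tmul_left_injective {k W V : Type*} [Field k] [AddCommGroup W] [Module k W]
    [AddCommGroup V] [Module k V] {w : W} (hw : w ≠ 0) :
    Function.Injective fun v : V => w ⊗ₜ[k] v := by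
  obtain ⟨f, hf⟩ := Module.Projective.exists_dual_eq_one k hw
  refine Function.LeftInverse.injective
    (g := (TensorProduct.lid k V).toLinearMap.comp (LinearMap.rTensor V f)) fun v => ?_
  simp [hf]

end MatrixModules

/-! ### The corner of `W ⊗ V`. -/

section TensorCorner

variable {k : Type u} [Field k] {X : Type v} [Finite X] {R : OrderRel X}
  {s : Equiv.Perm X ⧸ R.stab → Equiv.Perm X}

/-- The representative of the trivial coset need not be the identity, only some `h ∈ Σ_R`; this
accounts for the conjugation by `h`. -/
theorem fIdem_mul_stabMap_eq_matrixUnitLift {j : Equiv.Perm X ⧸ R.stab} {h : R.stab}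
    (hj : s j = h) (b : MonoidAlgebra k R.stab) :
    fIdem k R * stabMap k R b =
      matrixUnitLift R s j j (MonoidAlgebra.of k _ h⁻¹ * b * MonoidAlgebra.of k _ h) := by
  have h1 : permClass k (s j) = stabMap k R (MonoidAlgebra.of k _ h) := by
    rw [stabMap_of, hj]
  have h2 : permClass k (s j)⁻¹ = stabMap k R (MonoidAlgebra.of k _ h⁻¹) := by
    rw [stabMap_of, hj]
    rfl
  have h3 : (MonoidAlgebra.of k R.stab h) * MonoidAlgebra.of k R.stab h⁻¹ = 1 := by
    rw [← map_mul, mul_inv_cancel, map_one]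
  rw [matrixUnitLift, h1, h2, stabMap_mul_fIdem, mul_assoc, mul_assoc, ← map_mul, ← map_mul]
  congr 2
  rw [← mul_assoc, ← mul_assoc, ← mul_assoc, h3, one_mul, mul_assoc, h3, mul_one]

/-- At the trivial coset `j`, the idempotent `f_R` acts as `E_jj`, and `E_jj W` is a line `k w₀`, so
the corner is `w₀ ⊗ V`. It generates, since the matrix units move it into every other row. -/
theorem exists_isModuleCorner_tensor
    (hs : ∀ j, (QuotientGroup.mk (s j) : Equiv.Perm X ⧸ R.stab) = j)
    {W V : Type*} [AddCommGroup W] [AddCommGroup V] [Module k W] [Module k V]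
    [Module (Matrix (Equiv.Perm X ⧸ R.stab) (Equiv.Perm X ⧸ R.stab) k) W]
    [IsScalarTower k (Matrix (Equiv.Perm X ⧸ R.stab) (Equiv.Perm X ⧸ R.stab) k) W]
    [Module (MonoidAlgebra k R.stab) V] [IsScalarTower k (MonoidAlgebra k R.stab) V]
    [IsSimpleModule (Matrix (Equiv.Perm X ⧸ R.stab) (Equiv.Perm X ⧸ R.stab) k) W]
    [IsSimpleModule (MonoidAlgebra k R.stab) V]
    {_ : Module (PermutedOrderAlgebra k X) (W ⊗[k] V)}
    (hact : ∀ (x : PermutedOrderAlgebra k X) (t : W ⊗[k] V),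
      x • t = matrixTensorEnd k _ _ W V (leftMulMatrix hs x) t) :
    HasCorner k R V (W ⊗[k] V) ∧ IsSimpleModule (PermutedOrderAlgebra k X) (W ⊗[k] V) := by
  let I := Equiv.Perm X ⧸ R.stab
  let j : I := QuotientGroup.mk 1
  have hmem : s j ∈ R.stab := by
    have h1 := QuotientGroup.eq.1 (hs j).symm
    rwa [inv_one, one_mul] at h1
  let h : R.stab := ⟨s j, hmem⟩
  have hlift := fIdem_mul_stabMap_eq_matrixUnitLift (k := k) (j := j) (h := h) rfl
  have hunit : ∀ (i l : I) (a : MonoidAlgebra k R.stab) (w : W) (v : V),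
      matrixUnitLift R s i l a • (w ⊗ₜ[k] v) =
      ((Matrix.single i l 1 : Matrix I I k) • w) ⊗ₜ[k] (a • v) := by
    intro i l a w v
    rw [hact, leftMulMatrix_matrixUnitLift, matrixTensorEnd_single]
  have hf : fIdem k R = matrixUnitLift R s j j 1 := by
    have := hlift 1
    rwa [map_one, mul_one, mul_one, ← map_mul, inv_mul_cancel, map_one] at this
  obtain ⟨w₀, hw₀, hjw⟩ := exists_single_smul_eq (k := k) (W := W) j
  have hfix : ∀ v : V, fIdem k R • (w₀ ⊗ₜ[k] v) = w₀ ⊗ₜ[k] v := by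
    intro v
    rw [hf, hunit, hjw, one_smul]
  have hinv : ∀ v : V, MonoidAlgebra.of k R.stab h • MonoidAlgebra.of k R.stab h⁻¹ • v = v := by
    intro v
    rw [smul_smul, ← map_mul, mul_inv_cancel, map_one, one_smul]
  have hinv' : ∀ v : V, MonoidAlgebra.of k R.stab h⁻¹ • MonoidAlgebra.of k R.stab h • v = v := by
    intro v
    rw [smul_smul, ← map_mul, inv_mul_cancel, map_one, one_smul]
  have hcoef := exists_smul_of_single_smul (k := k) hw₀ hjw
  have hrange : ∀ t : W ⊗[k] V, ∃ v, fIdem k R • t = w₀ ⊗ₜ[k] v := by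
    intro t
    induction t with
    | zero => exact ⟨0, by simp⟩
    | tmul w v =>
      obtain ⟨c, hc⟩ := hcoef w
      exact ⟨c • v, by rw [hf, hunit, hc, one_smul, TensorProduct.smul_tmul]⟩
    | add t t' ht ht' =>
      obtain ⟨v, hv⟩ := ht
      obtain ⟨v', hv'⟩ := ht'
      exact ⟨v + v', by rw [smul_add, hv, hv', TensorProduct.tmul_add]⟩
  -- Because `f_R b` acts on `w₀ ⊗ V` through `h⁻¹ b h`, the twist by `h⁻¹` is needed for
  -- equivariance.
  let ι : V →+ W ⊗[k] V :=
    { toFun := fun v => w₀ ⊗ₜ[k] (MonoidAlgebra.of k R.stab h⁻¹ • v)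
      map_zero' := by simp
      map_add' := fun v v' => by rw [smul_add, TensorProduct.tmul_add] }
  have hι : ∀ v, ι v = w₀ ⊗ₜ[k] (MonoidAlgebra.of k R.stab h⁻¹ • v) := fun v => rfl
  have hι' : ∀ v, w₀ ⊗ₜ[k] v = ι (MonoidAlgebra.of k R.stab h • v) := fun v => by
    rw [hι, hinv']
  have hcorner : IsModuleCorner (stabMap k R).toRingHom (fIdem k R) ι := by
    refine ⟨fun v v' hvv => ?_, fun b v => ?_, fun v => hfix _, fun t ht => ?_⟩
    · have := tmul_left_injective hw₀ hvv
      rw [← hinv v, ← hinv v']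
      exact congrArg _ this
    · change _ = stabMap k R b • ι v
      rw [hι v, ← hfix, smul_smul, stabMap_mul_fIdem, hlift, hunit, hjw, hι, smul_smul, smul_smul,
        mul_assoc _ _ (MonoidAlgebra.of k R.stab h⁻¹), ← map_mul, mul_inv_cancel, map_one, mul_one]
    · obtain ⟨v, hv⟩ := hrange t
      exact ⟨_, ((hι' v).symm.trans hv.symm).trans ht⟩
  refine ⟨⟨ι, hcorner⟩, hcorner.isSimpleModule_of_generates (isCornerMap R) ?_ ?_⟩
  · rw [eq_top_iff]
    rintro t -
    induction t with
    | zero => exact zero_mem _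
    | add t t' ht ht' => exact add_mem ht ht'
    | tmul w v =>
      rw [← sum_single_smul (k := k) (n := I) w, TensorProduct.sum_tmul]
      refine sum_mem fun i _ => ?_
      obtain ⟨c, hc⟩ := hcoef ((Matrix.single j i 1 : Matrix I I k) • w)
      have h1 : (Matrix.single i i 1 : Matrix I I k) =
          Matrix.single i j 1 * (Matrix.single j j 1 * Matrix.single j i 1) := by simp
      have h2 : ((Matrix.single i i 1 : Matrix I I k) • w) ⊗ₜ[k] v =
          matrixUnitLift R s i j (1 : MonoidAlgebra k R.stab) •
            ι (MonoidAlgebra.of k R.stab h • c • v) := by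
        rw [← hι', hunit, one_smul, h1, mul_smul, mul_smul, hc, smul_comm, TensorProduct.smul_tmul]
      rw [h2]
      exact Submodule.smul_mem _ _ (Submodule.subset_span ⟨_, rfl⟩)
  · intro t ht
    by_contra! hzero
    refine ht ?_
    -- The identity is `∑ E_ii = ∑ E_ij E_jj E_ji` and `E_jj` is `f_R`; so `t` vanishes if `f_R`
    -- kills all its multiples.
    have h1 : ∑ i : I, matrixUnitLift R s i i (1 : MonoidAlgebra k R.stab) • t = t := by
      rw [← Finset.sum_smul, hact, map_sum]
      simp only [leftMulMatrix_matrixUnitLift, Matrix.sum_single_one, map_one]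
      rfl
    rw [← h1]
    refine Finset.sum_eq_zero fun i _ => ?_
    have h2 : matrixUnitLift R s i i (1 : MonoidAlgebra k R.stab) • t =
        matrixUnitLift R s i j (1 : MonoidAlgebra k R.stab) • fIdem k R •
          matrixUnitLift R s j i (1 : MonoidAlgebra k R.stab) • t := by
      simp only [hact, hf, ← Module.End.mul_apply, ← map_mul, leftMulMatrix_matrixUnitLift]
      simp
    rw [h2, hzero, smul_zero]

end TensorCorner

/-! ### The corner of the induced module. -/

section Induced

variable {k : Type u} [Field k] {X : Type v} [Finite X]

/-- The generator `f_R` of the left ideal `𝒫 f_R`. -/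
noncomputable def leftIdealGen (k : Type u) [Field k] (R : OrderRel X) : leftIdealF k R :=
  ⟨fIdem k R, Ideal.subset_span rfl⟩

theorem exists_smul_leftIdealGen {R : OrderRel X} (x : leftIdealF k R) :
    ∃ y : PermutedOrderAlgebra k X, y • leftIdealGen k R = x := by
  obtain ⟨y, hy⟩ := Ideal.mem_span_singleton'.1 x.2
  exact ⟨y, Subtype.ext hy⟩

theorem op_smul_leftIdealGen (R : OrderRel X) (b : MonoidAlgebra k R.stab) :
    MulOpposite.op b • leftIdealGen k R = stabMap k R b • leftIdealGen k R :=
  Subtype.ext (stabMap_mul_fIdem k R b).symm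

/-- In `1 = ∑ f_S`, the terms outside the orbit of `R` kill `N` by hypothesis, and those inside are
conjugates of `f_R`. -/
theorem exists_smul_fIdem_smul_ne_zero {R : OrderRel X} {N : Type*} [AddCommGroup N]
    [Module (PermutedOrderAlgebra k X) N]
    (h : ∀ (S : OrderRel X) (n : N), (∀ σ : Equiv.Perm X, S ≠ σ • R) → fIdem k S • n = 0)
    (n : N) (hn : n ≠ 0) : ∃ a : PermutedOrderAlgebra k X, fIdem k R • a • n ≠ 0 := by
  by_contra! h0
  refine hn ?_
  rw [← one_smul (PermutedOrderAlgebra k X) n, ← sum_fIdem, Finset.sum_smul]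
  refine Finset.sum_eq_zero fun S _ => ?_
  by_cases hS : ∃ σ : Equiv.Perm X, S = σ • R
  · obtain ⟨σ, rfl⟩ := hS
    rw [← permClass_mul_fIdem_conj rfl, mul_smul, mul_smul, h0, smul_zero]
  · push Not at hS
    exact h S n hS

theorem IsModuleCorner.map_smul_scalar {R : OrderRel X} {V M : Type*} [AddCommGroup V] [Module k V]
    [Module (MonoidAlgebra k R.stab) V] [IsScalarTower k (MonoidAlgebra k R.stab) V]
    [AddCommGroup M] [Module k M] [Module (PermutedOrderAlgebra k X) M]
    [IsScalarTower k (PermutedOrderAlgebra k X) M] {κ : V →+ M}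
    (hκ : IsModuleCorner (stabMap k R).toRingHom (fIdem k R) κ) (r : k) (v : V) :
    κ (r • v) = r • κ v := by
  rw [← algebraMap_smul (MonoidAlgebra k R.stab) r v, hκ.map_smul,
    ← algebraMap_smul (PermutedOrderAlgebra k X) r (κ v)]
  congr 1
  exact (stabMap k R).commutes r

variable {R : OrderRel X} {V M : Type*} [AddCommGroup V] [Module k V]
  [Module (MonoidAlgebra k R.stab) V] [IsScalarTower k (MonoidAlgebra k R.stab) V]
  [AddCommGroup M] [Module k M] [Module (PermutedOrderAlgebra k X) M]
  [IsScalarTower k (PermutedOrderAlgebra k X) M]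

/-- The homomorphism `𝒫 f_R ⊗ V → M` induced by a homomorphism from `V` to the corner of `M`. -/
noncomputable def inducedLift {κ : V →+ M}
    (hκ : IsModuleCorner (stabMap k R).toRingHom (fIdem k R) κ) :
    BimodTensor k (MonoidAlgebra k R.stab) (PermutedOrderAlgebra k X) (leftIdealF k R) V
      →ₗ[PermutedOrderAlgebra k X] M :=
  Submodule.liftQ _ (TensorProduct.AlgebraTensorModule.lift
    { toFun := fun x =>
        { toFun := fun v => x.1 • κ v
          map_add' := fun v v' => by rw [map_add, smul_add]
          map_smul' := fun r v => by
            rw [hκ.map_smul_scalar, RingHom.id_apply, smul_algebra_smul_comm] }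
      map_add' := fun x y => LinearMap.ext fun v => add_smul x.1 y.1 (κ v)
      map_smul' := fun a x => LinearMap.ext fun v => mul_smul a x.1 (κ v) }) (by
    rw [Submodule.span_le]
    rintro _ ⟨x, b, v, rfl⟩
    change _ = _
    rw [map_sub, sub_eq_zero]
    change (x.1 * stabMap k R b) • κ v = x.1 • κ (b • v)
    rw [hκ.map_smul, mul_smul]
    rfl)

/-- The only delicate point is that `v ↦ f_R ⊗ v` is injective. Any module `M` already known to have
corner `V` proves it: the induced map `𝒫 f_R ⊗ V → M` sends `f_R ⊗ v` to `κ v`. -/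
theorem hasCorner_bimodTensor {κ : V →+ M}
    (hκ : IsModuleCorner (stabMap k R).toRingHom (fIdem k R) κ)
    [IsSimpleModule (MonoidAlgebra k R.stab) V] :
    HasCorner k R V (BimodTensor k (MonoidAlgebra k R.stab) (PermutedOrderAlgebra k X)
      (leftIdealF k R) V) ∧
    IsSimpleModule (PermutedOrderAlgebra k X)
      (BimodTensor k (MonoidAlgebra k R.stab) (PermutedOrderAlgebra k X) (leftIdealF k R) V) := by
  let N := BimodTensor k (MonoidAlgebra k R.stab) (PermutedOrderAlgebra k X) (leftIdealF k R) V
  let S : Submodule (PermutedOrderAlgebra k X) (leftIdealF k R ⊗[k] V) :=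
    Submodule.span (PermutedOrderAlgebra k X) {t : leftIdealF k R ⊗[k] V |
      ∃ (m : leftIdealF k R) (a : MonoidAlgebra k R.stab) (n : V),
        t = (MulOpposite.op a • m) ⊗ₜ[k] n - m ⊗ₜ[k] (a • n)}
  let q : leftIdealF k R ⊗[k] V →ₗ[PermutedOrderAlgebra k X] N := S.mkQ
  have hq : Function.Surjective q := S.mkQ_surjective
  have hbal : ∀ (x : leftIdealF k R) (b : MonoidAlgebra k R.stab) (v : V),
      q ((MulOpposite.op b • x) ⊗ₜ[k] v) = q (x ⊗ₜ[k] (b • v)) := by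
    intro x b v
    rw [← sub_eq_zero, ← map_sub]
    exact (Submodule.Quotient.mk_eq_zero S).2 (Submodule.subset_span ⟨x, b, v, rfl⟩)
  have hsmul : ∀ (a : PermutedOrderAlgebra k X) (x : leftIdealF k R) (v : V),
      a • q (x ⊗ₜ[k] v) = q ((a • x) ⊗ₜ[k] v) := fun a x v => by
    rw [← map_smul]
    rfl
  let ι : V →+ N :=
    { toFun := fun v => q (leftIdealGen k R ⊗ₜ[k] v)
      map_zero' := by rw [TensorProduct.tmul_zero, map_zero]
      map_add' := fun v v' => by rw [TensorProduct.tmul_add, map_add] }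
  have hι : ∀ v, ι v = q (leftIdealGen k R ⊗ₜ[k] v) := fun v => rfl
  have hstab : ∀ (b : MonoidAlgebra k R.stab) v, stabMap k R b • ι v = ι (b • v) := by
    intro b v
    rw [hι, hsmul, ← op_smul_leftIdealGen, hbal, hι]
  have hfix : ∀ v, fIdem k R • ι v = ι v := by
    intro v
    rw [hι, hsmul]
    congr 2
    exact Subtype.ext (fIdem_mul_self R)
  have hgen : ∀ (x : leftIdealF k R) (v : V), ∃ y : PermutedOrderAlgebra k X,
      q (x ⊗ₜ[k] v) = y • ι v := by
    intro x v
    obtain ⟨y, rfl⟩ := exists_smul_leftIdealGen x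
    exact ⟨y, by rw [hι, hsmul]⟩
  have hrange : ∀ n : N, ∃ v, fIdem k R • n = ι v := by
    intro n
    obtain ⟨t, rfl⟩ := hq n
    induction t with
    | zero => exact ⟨0, by simp⟩
    | add t t' ht ht' =>
      obtain ⟨v, hv⟩ := ht
      obtain ⟨v', hv'⟩ := ht'
      exact ⟨v + v', by rw [map_add, smul_add, hv, hv', map_add]⟩
    | tmul x v =>
      obtain ⟨y, hy⟩ := hgen x v
      -- Here `f_R y f_R = f_R b` with `b ∈ kΣ_R`, and `b` moves across the tensor sign.
      obtain ⟨b, hb⟩ := (isCornerMap (k := k) R).exists_eq y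
      refine ⟨b • v, ?_⟩
      rw [hy, ← hfix v, smul_smul, smul_smul, hb, mul_smul]
      change fIdem k R • stabMap k R b • ι v = _
      rw [hstab, hfix]
  have hcorner : IsModuleCorner (stabMap k R).toRingHom (fIdem k R) ι := by
    refine ⟨fun v v' hvv => ?_, fun b v => (hstab b v).symm, hfix, fun n hn => ?_⟩
    · have h1 : ∀ v, inducedLift hκ (ι v) = κ v := fun v => hκ.smul_apply v
      exact hκ.injective (by rw [← h1 v, ← h1 v', hvv])
    · obtain ⟨v, hv⟩ := hrange n
      exact ⟨v, hv.symm.trans hn⟩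
  refine ⟨⟨ι, hcorner⟩, hcorner.isSimpleModule_of_generates (isCornerMap R) ?_
    (exists_smul_fIdem_smul_ne_zero ?_)⟩
  · rw [eq_top_iff]
    rintro n -
    obtain ⟨t, rfl⟩ := hq n
    induction t with
    | zero => rw [map_zero]; exact zero_mem _
    | add t t' ht ht' => rw [map_add]; exact add_mem ht ht'
    | tmul x v =>
      obtain ⟨y, hy⟩ := hgen x v
      rw [hy]
      exact Submodule.smul_mem _ _ (Submodule.subset_span ⟨v, rfl⟩)
  · intro T n hT
    obtain ⟨t, rfl⟩ := hq n
    induction t with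
    | zero => simp
    | add t t' ht ht' => rw [map_add, smul_add, ht, ht', add_zero]
    | tmul x v =>
      obtain ⟨y, hy⟩ := hgen x v
      rw [hy, ← hfix v, smul_smul, smul_smul, mul_assoc, fIdem_mul_mul_fIdem_eq_zero hT, zero_smul]

end Induced

/-! ### The bijection between pairs and simple modules. -/

section Classification

variable {k : Type u} [Field k] {X : Type v} [Finite X]

open scoped ModuleCat

theorem SimpleMod.cls_eq_cls {A : Type u} [Ring A] {M N : SimpleMod.{u, w} A} :
    M.cls = N.cls ↔ Nonempty (M.1 ≃ₗ[A] N.1) :=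
  ⟨fun h => Quotient.exact h, fun h => Quotient.sound h⟩

theorem exists_cosetRep {X : Type v} (R : OrderRel X) : ∃ s : Equiv.Perm X ⧸ R.stab → Equiv.Perm X,
    ∀ j, (QuotientGroup.mk (s j) : Equiv.Perm X ⧸ R.stab) = j :=
  ⟨Quotient.out, fun j => Quotient.out_eq' j⟩

theorem hasCorner_matrixTensorModule {R : OrderRel X}
    {s : Equiv.Perm X ⧸ R.stab → Equiv.Perm X}
    (hs : ∀ j, (QuotientGroup.mk (s j) : Equiv.Perm X ⧸ R.stab) = j)
    (V : SimpleMod.{max u v, max u v w} (MonoidAlgebra k R.stab))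
    (W : SimpleMod.{max u v, max u v w}
      (Matrix (Equiv.Perm X ⧸ R.stab) (Equiv.Perm X ⧸ R.stab) k)) :
    HasCorner k R V.1 (matrixTensorModule.{u, v, w} (leftMulMatrix hs) W.1 V.1) ∧
      IsSimpleModule (PermutedOrderAlgebra k X)
        (matrixTensorModule.{u, v, w} (leftMulMatrix hs) W.1 V.1) := by
  have := V.2
  have := W.2
  exact exists_isModuleCorner_tensor hs fun _ _ => rfl

/-- The module `W ⊗ V` serves as the auxiliary module with corner `V`. -/
theorem hasCorner_inducedModule {R : OrderRel X}
    (V : SimpleMod.{max u v, max u v w} (MonoidAlgebra k R.stab)) :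
    HasCorner k R V.1 (inducedModule.{u, v, w} R V.1) ∧
      IsSimpleModule (PermutedOrderAlgebra k X) (inducedModule.{u, v, w} R V.1) := by
  have := V.2
  obtain ⟨s, hs⟩ := exists_cosetRep R
  obtain ⟨huniq⟩ := nonempty_unique_simpleIso_matrix.{u, v, w} k (Equiv.Perm X ⧸ R.stab)
  obtain ⟨W, -⟩ := Quotient.exists_rep huniq.default
  obtain ⟨⟨κ, hκ⟩, -⟩ := hasCorner_matrixTensorModule.{u, v, w} hs V W
  exact hasCorner_bimodTensor hκ

theorem HasCorner.of_linearEquiv {R : OrderRel X} {V V' M M' : Type*} [AddCommGroup V]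
    [Module (MonoidAlgebra k R.stab) V] [AddCommGroup V'] [Module (MonoidAlgebra k R.stab) V']
    [AddCommGroup M] [Module (PermutedOrderAlgebra k X) M]
    [AddCommGroup M'] [Module (PermutedOrderAlgebra k X) M']
    (h : HasCorner k R V M) (φ : V' ≃ₗ[MonoidAlgebra k R.stab] V)
    (ψ : M ≃ₗ[PermutedOrderAlgebra k X] M') : HasCorner k R V' M' := by
  obtain ⟨ι, hι⟩ := h
  exact ⟨_, hι.comp_linearEquiv φ ψ⟩

theorem HasCorner.cls_eq {R : OrderRel X}
    {V V' : SimpleMod.{max u v, w} (MonoidAlgebra k R.stab)}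
    {M M' : SimpleMod.{max u v, w} (PermutedOrderAlgebra k X)} (hV : V.cls = V'.cls)
    (h : HasCorner k R V.1 M.1) (h' : HasCorner k R V'.1 M'.1) : M.cls = M'.cls := by
  obtain ⟨e⟩ := SimpleMod.cls_eq_cls.1 hV
  have := V.2
  have := M.2
  have := M'.2
  have : Nontrivial V.1 := IsSimpleModule.nontrivial (MonoidAlgebra k R.stab) V.1
  obtain ⟨ι, hι⟩ := h
  obtain ⟨ι', hι'⟩ := h'.of_linearEquiv e (LinearEquiv.refl _ _)
  exact SimpleMod.cls_eq_cls.2 (hι.nonempty_linearEquiv hι' (isCornerMap R))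

/-- Multiplication by `Δ_σ` carries `f_R M` onto `f_{σR} M` and conjugates the stabilizer action. -/
theorem HasCorner.conj {R : OrderRel X} {V : SimpleMod.{max u v, w} (MonoidAlgebra k R.stab)}
    {M : Type*} [AddCommGroup M] [Module (PermutedOrderAlgebra k X) M] (h : HasCorner k R V.1 M)
    (σ : Equiv.Perm X) :
    HasCorner k (σ • R) (V.restrict (conjHom k σ R) (conjHom_surjective k σ R)).1 M := by
  obtain ⟨ι, hι⟩ := h
  have hconj : ∀ b : MonoidAlgebra k (σ • R).stab,
      permClass k σ * stabMap k R (conjHom k σ R b) = stabMap k (σ • R) b * permClass k σ := by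
    intro b
    induction b using MonoidAlgebra.induction_on with
    | of h =>
      have h1 : conjHom k σ R (MonoidAlgebra.of k _ h) = MonoidAlgebra.of k _
          ((MulAction.stabilizerEquivStabilizer (rfl : σ • R = σ • R)).symm h) := by
        simp [conjHom]
      rw [h1, stabMap_of, stabMap_of, ← map_mul, ← map_mul]
      congr 1
      rw [MulAction.stabilizerEquivStabilizer_symm_apply]
      simp [mul_assoc]
    | add a b ha hb => rw [map_add, map_add, mul_add, ha, hb, map_add, add_mul]
    | smul r a ha =>
      have h1 : conjHom k σ R (r • a) = r • conjHom k σ R a :=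
        map_smul (MonoidAlgebra.mapDomainAlgHom k k _) r a
      rw [h1, map_smul, mul_smul_comm, ha, map_smul, smul_mul_assoc]
  refine ⟨{ toFun := fun v => permClass k σ • ι v, map_zero' := ?_, map_add' := ?_ },
    ⟨?_, ?_, ?_, ?_⟩⟩
  · exact (congrArg _ ι.map_zero).trans (smul_zero _)
  · exact fun v v' => (congrArg _ (ι.map_add v v')).trans (smul_add _ _ _)
  · intro v v' hvv
    have h1 := congrArg (permClass k σ⁻¹ • ·) hvv
    change permClass k σ⁻¹ • permClass k σ • ι v = permClass k σ⁻¹ • permClass k σ • ι v' at h1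
    rw [smul_smul, smul_smul, permClass_inv_mul_permClass, one_smul, one_smul] at h1
    exact hι.injective h1
  · intro b (v : V.1)
    change permClass k σ • ι (conjHom k σ R b • v) =
      stabMap k (σ • R) b • permClass k σ • ι v
    rw [hι.map_smul, smul_smul, smul_smul]
    congr 1
    exact hconj b
  · intro (v : V.1)
    change fIdem k (σ • R) • permClass k σ • ι v = permClass k σ • ι v
    rw [smul_smul, ← permClass_mul_fIdem, mul_smul, hι.smul_apply]
  · intro m hm
    have h1 : fIdem k R • permClass k σ⁻¹ • m = permClass k σ⁻¹ • m := by
      conv_rhs => rw [← hm]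
      rw [smul_smul, smul_smul, permClass_mul_fIdem, inv_smul_smul]
    obtain ⟨v, hv⟩ := hι.exists_eq _ h1
    refine ⟨v, ?_⟩
    change permClass k σ • ι v = m
    rw [hv, smul_smul, permClass_mul_permClass_inv, one_smul]

/-- In a simple module some `a` carries a nonzero vector of one corner to one of the other, so `f_R'
𝒫 f_R ≠ 0` and the orders are conjugate. After transport by `Δ_σ`, both modules are the same corner
of `M`. -/
theorem HasCorner.pairClass_eq {R R' : OrderRel X}
    {V : SimpleMod.{max u v, w} (MonoidAlgebra k R.stab)}
    {V' : SimpleMod.{max u v, w} (MonoidAlgebra k R'.stab)}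
    {M : SimpleMod.{max u v, w} (PermutedOrderAlgebra k X)}
    (h : HasCorner k R V.1 M.1) (h' : HasCorner k R' V'.1 M.1) :
    pairClass R V = pairClass R' V' := by
  have hσ : ∃ σ : Equiv.Perm X, R' = σ • R := by
    by_contra! hσ
    obtain ⟨ι, hι⟩ := h
    obtain ⟨ι', hι'⟩ := h'
    have := V.2
    have := V'.2
    have := M.2
    have : Nontrivial V.1 := IsSimpleModule.nontrivial (MonoidAlgebra k R.stab) V.1
    have : Nontrivial V'.1 := IsSimpleModule.nontrivial (MonoidAlgebra k R'.stab) V'.1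
    obtain ⟨v, hv⟩ := exists_ne (0 : V.1)
    obtain ⟨v', hv'⟩ := exists_ne (0 : V'.1)
    have h1 : ι v ≠ 0 := fun h0 => hv (hι.injective (h0.trans ι.map_zero.symm))
    have h2 : ι' v' ≠ 0 := fun h0 => hv' (hι'.injective (h0.trans ι'.map_zero.symm))
    obtain ⟨a, ha⟩ := IsSimpleModule.exists_smul_eq (A := PermutedOrderAlgebra k X) h1 (ι' v')
    refine h2 ?_
    rw [← hι'.smul_apply, ← ha, ← hι.smul_apply, smul_smul, smul_smul, mul_assoc,
      fIdem_mul_mul_fIdem_eq_zero hσ, zero_smul]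
  obtain ⟨σ, rfl⟩ := hσ
  obtain ⟨ι, hι⟩ := h.conj σ
  obtain ⟨ι', hι'⟩ := h'
  refine (Quotient.sound (s := MulAction.orbitRel (Equiv.Perm X) (OrderPair.{u, v, w} k X))
    (MulAction.mem_orbit_iff.2 ⟨σ, congrArg (Sigma.mk (σ • R)) ?_⟩)).symm
  exact (SimpleMod.cls_eq_cls (M := V.restrict (conjHom k σ R) (conjHom_surjective k σ R))
    (N := V')).2 (hι.nonempty_linearEquiv_corner hι')

/-- Since the `f_R` sum to `1`, some `f_R M` is nonzero, and a nonzero corner of a simple module is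
simple. -/
theorem exists_hasCorner (M : SimpleMod.{max u v, w} (PermutedOrderAlgebra k X)) :
    ∃ (R : OrderRel X) (V : SimpleMod.{max u v, w} (MonoidAlgebra k R.stab)),
      HasCorner k R V.1 M.1 := by
  have := M.2
  have : Nontrivial M.1 := IsSimpleModule.nontrivial (PermutedOrderAlgebra k X) M.1
  obtain ⟨m, hm⟩ := exists_ne (0 : M.1)
  obtain ⟨R, hR⟩ : ∃ R : OrderRel X, fIdem k R • m ≠ 0 := by
    by_contra! h
    refine hm ?_
    rw [← one_smul (PermutedOrderAlgebra k X) m, ← sum_fIdem, Finset.sum_smul]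
    exact Finset.sum_eq_zero fun R _ => h R
  let _ := fixedPartModule (M := M.1) (isCornerMap (k := k) R)
  have hcorner := isModuleCorner_fixedPart (M := M.1) (isCornerMap (k := k) R)
  have : Nontrivial (fixedPart (fIdem k R) M.1) :=
    ⟨⟨fIdem k R • m, by
      change fIdem k R • fIdem k R • m = _
      rw [smul_smul, fIdem_mul_self]⟩, 0, fun h => hR (congrArg Subtype.val h)⟩
  exact ⟨R, ⟨ModuleCat.of (MonoidAlgebra k R.stab) (fixedPart (fIdem k R) M.1),
    hcorner.isSimpleModule (isCornerMap R)⟩, _, hcorner⟩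

/-- The isomorphism class of the simple `𝒫`-module attached to a pair. -/
noncomputable def simpleOfPair (p : OrderPair.{u, v, max u v w} k X) :
    SimpleIso.{max u v, max u v w} (PermutedOrderAlgebra k X) :=
  Quotient.lift (fun V : SimpleMod.{max u v, max u v w} (MonoidAlgebra k p.1.stab) =>
      SimpleMod.cls ⟨inducedModule.{u, v, w} p.1 V.1, (hasCorner_inducedModule V).2⟩)
    (fun V V' h => HasCorner.cls_eq (SimpleMod.cls_eq_cls.2 h) (hasCorner_inducedModule V).1
      (hasCorner_inducedModule V').1) p.2

/-- The induced module is one simple module with corner `V`, and a simple module is determined by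
its corner. Everything about the bijection can thus be checked on corners. -/
theorem simpleOfPair_eq_iff {R : OrderRel X}
    {V : SimpleMod.{max u v, max u v w} (MonoidAlgebra k R.stab)}
    {M : SimpleMod.{max u v, max u v w} (PermutedOrderAlgebra k X)} :
    simpleOfPair.{u, v, w} ⟨R, V.cls⟩ = M.cls ↔ HasCorner k R V.1 M.1 := by
  constructor
  · intro h
    obtain ⟨e⟩ := SimpleMod.cls_eq_cls.1 h
    exact (hasCorner_inducedModule V).1.of_linearEquiv (LinearEquiv.refl _ _) e
  · exact fun h => HasCorner.cls_eq rfl (hasCorner_inducedModule V).1 h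

/-- The bijection between conjugacy classes of pairs and isomorphism classes of simple modules. -/
noncomputable def simpleEquiv :
    MulAction.orbitRel.Quotient (Equiv.Perm X) (OrderPair.{u, v, max u v w} k X) ≃
      SimpleIso.{max u v, max u v w} (PermutedOrderAlgebra k X) :=
  Equiv.ofBijective (Quotient.lift simpleOfPair.{u, v, w} (by
    rintro _ ⟨R, x⟩ ⟨σ, rfl⟩
    obtain ⟨V, rfl⟩ := Quotient.exists_rep x
    have h := (hasCorner_inducedModule.{u, v, w} V).1
    let M : SimpleMod.{max u v, max u v w} (PermutedOrderAlgebra k X) :=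
      ⟨inducedModule.{u, v, w} R V.1, (hasCorner_inducedModule V).2⟩
    exact ((simpleOfPair_eq_iff (M := M)
      (V := V.restrict (conjHom k σ R) (conjHom_surjective k σ R))).2 (h.conj σ)).trans
      ((simpleOfPair_eq_iff (M := M)).2 h).symm)) (by
    constructor
    · intro p p' h
      obtain ⟨⟨R, x⟩, rfl⟩ := Quotient.exists_rep p
      obtain ⟨⟨R', x'⟩, rfl⟩ := Quotient.exists_rep p'
      obtain ⟨V, rfl⟩ := Quotient.exists_rep x
      obtain ⟨V', rfl⟩ := Quotient.exists_rep x'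
      change simpleOfPair ⟨R, V.cls⟩ = simpleOfPair ⟨R', V'.cls⟩ at h
      have h1 := (hasCorner_inducedModule.{u, v, w} V').1
      have h2 : simpleOfPair ⟨R', V'.cls⟩ = SimpleMod.cls ⟨_, (hasCorner_inducedModule V').2⟩ :=
        simpleOfPair_eq_iff.2 h1
      have h3 := simpleOfPair_eq_iff.1 (h.trans h2)
      exact HasCorner.pairClass_eq (M := ⟨_, (hasCorner_inducedModule V').2⟩) h3 h1
    · intro M
      obtain ⟨M, rfl⟩ := Quotient.exists_rep M
      obtain ⟨R, V, h⟩ := exists_hasCorner M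
      exact ⟨Quotient.mk _ ⟨R, V.cls⟩, simpleOfPair_eq_iff.2 h⟩)

theorem simpleEquiv_pairClass_eq_iff {R : OrderRel X}
    {V : SimpleMod.{max u v, max u v w} (MonoidAlgebra k R.stab)}
    {M : SimpleMod.{max u v, max u v w} (PermutedOrderAlgebra k X)} :
    simpleEquiv.{u, v, w} (pairClass R V) = M.cls ↔ HasCorner k R V.1 M.1 :=
  simpleOfPair_eq_iff

theorem dimOver_lt_aleph0 {R : OrderRel X}
    (V : SimpleMod.{max u v, w} (MonoidAlgebra k R.stab)) : dimOver k V.1 < Cardinal.aleph0 := by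
  have := V.2
  have : Module.Finite (MonoidAlgebra k R.stab) V.1 := inferInstance
  have : Module.Finite k V.1 := Module.Finite.trans (MonoidAlgebra k R.stab) V.1
  exact Module.rank_lt_aleph0 k V.1

theorem dimOver_eq_of_linearEquiv {A : Type v} [Ring A] [Algebra k A] {M N : ModuleCat.{w} A}
    (e : M ≃ₗ[A] N) : dimOver k M = dimOver k N :=
  (e.restrictScalars k).rank_eq

theorem dimOver_matrixTensorModule {R : OrderRel X}
    (φ : PermutedOrderAlgebra k X →ₐ[k] Matrix (Equiv.Perm X ⧸ R.stab) (Equiv.Perm X ⧸ R.stab)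
      (MonoidAlgebra k R.stab))
    (V : SimpleMod.{max u v, max u v w} (MonoidAlgebra k R.stab))
    (W : SimpleMod.{max u v, max u v w}
      (Matrix (Equiv.Perm X ⧸ R.stab) (Equiv.Perm X ⧸ R.stab) k)) :
    dimOver k (matrixTensorModule.{u, v, w} φ W.1 V.1) =
      (R.stab.index : Cardinal) * dimOver k V.1 := by
  have := W.2
  -- The scalar action obtained through `𝒫` agrees with that of the tensor product because the
  -- action map is a `k`-algebra homomorphism.
  let e : matrixTensorModule.{u, v, w} φ W.1 V.1 ≃ₗ[k] W.1 ⊗[k] V.1 :=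
    { AddEquiv.refl (W.1 ⊗[k] V.1) with
      map_smul' := fun r t => by
        change matrixTensorEnd k (Equiv.Perm X ⧸ R.stab) (MonoidAlgebra k R.stab) W.1 V.1
          (φ (algebraMap k _ r)) t = r • (show W.1 ⊗[k] V.1 from t)
        rw [AlgHom.commutes, AlgHom.commutes]
        rfl }
  refine e.rank_eq.trans ?_
  rw [rank_tensorProduct', rank_simple_matrix_module.{u, v, w} (n := Equiv.Perm X ⧸ R.stab)]
  rfl

end Classification

/-! ### Nilpotency of the elements of `N` and inflation from the quotient. -/

namespace BinRel

variable {X : Type v}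

theorem mul_transClosure_eq {S Q : BinRel X} (h : S * Q = S) (hQ : Q.IsReflexive) :
    S * Q.transClosure = S := by
  refine ext fun x z => ⟨?_, fun hx => ⟨z, hx, hQ.transClosure z⟩⟩
  rintro ⟨y, hxy, hyz⟩
  change Relation.TransGen Q.Holds y z at hyz
  induction hyz with
  | single h1 => rw [← h]; exact ⟨y, hxy, h1⟩
  | tail _ h1 ih => rw [← h]; exact ⟨_, ih, h1⟩

theorem transClosure_mul_eq {S Q : BinRel X} (h : S * Q = S) (hQ : Q.IsReflexive) :
    S.transClosure * Q = S.transClosure := by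
  refine ext fun x z => ⟨?_, fun hx => ⟨z, hx, hQ z⟩⟩
  rintro ⟨y, hxy, hyz⟩
  change Relation.TransGen S.Holds x y at hxy
  cases hxy with
  | single h1 =>
    refine .single ?_
    rw [← h]
    exact ⟨y, h1, hyz⟩
  | tail h1 h2 =>
    refine .tail h1 ?_
    rw [← h]
    exact ⟨y, h2, hyz⟩

/-- The number of pairs in a relation. -/
noncomputable def size (S : BinRel X) : ℕ := (show Set (X × X) from S).ncard

theorem size_lt [Finite X] {S T : BinRel X} (h : ∀ x y, S.Holds x y → T.Holds x y)
    (hne : S ≠ T) : S.size < T.size := by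
  refine Set.ncard_lt_ncard (ssubset_of_subset_of_ne ?_ hne) (Set.toFinite _)
  exact fun p hp => h p.1 p.2 hp

theorem size_le [Finite X] (S : BinRel X) : S.size ≤ Nat.card (X × X) := by
  rw [← Set.ncard_univ]
  exact Set.ncard_le_ncard (Set.subset_univ _) (Set.toFinite _)

end BinRel

section Nilpotent

variable {k : Type u} [CommRing k] {X : Type v}

variable (k) in
/-- The difference between a relation and its transitive closure in the essential algebra. -/
noncomputable def closureDiff (S : BinRel X) : EssentialAlgebra k X :=
  essClass k S - essClass k S.transClosure

variable (k X) in
/-- The span of the elements `(S - S̄) Δ_σ` where the reflexive relation `S` has at least `j`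
elements. -/
noncomputable def nilFiltration (j : ℕ) : Submodule k (EssentialAlgebra k X) :=
  Submodule.span k {a | ∃ (S : BinRel X) (σ : Equiv.Perm X), S.IsReflexive ∧ j ≤ S.size ∧
    a = closureDiff k S * essClass k (BinRel.perm σ)}

theorem nilSubmodule_le_nilFiltration : nilSubmodule k X ≤ nilFiltration k X 0 := by
  refine Submodule.span_mono ?_
  rintro _ ⟨S, σ, hS, -, rfl⟩
  exact ⟨S, σ, hS, zero_le, rfl⟩

theorem perm_mul_closureDiff (σ : Equiv.Perm X) (S : BinRel X) :
    essClass k (BinRel.perm σ) * closureDiff k S =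
      closureDiff k (BinRel.perm σ * S * BinRel.perm σ⁻¹) * essClass k (BinRel.perm σ) := by
  have h : ∀ T : BinRel X, BinRel.perm σ * T * BinRel.perm σ⁻¹ * BinRel.perm σ =
      BinRel.perm σ * T := by
    intro T
    rw [mul_assoc _ (BinRel.perm σ⁻¹), ← BinRel.perm_mul, inv_mul_cancel, BinRel.perm_one, mul_one]
  rw [closureDiff, closureDiff, BinRel.transClosure_conj, mul_sub, sub_mul, ← map_mul, ← map_mul,
    ← map_mul, ← map_mul, h, h]

/-- The four products have the same transitive closure, so the subtracted closures cancel with signs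
`1 - 1 - 1 + 1`. -/
theorem closureDiff_mul {S Q : BinRel X} (hS : S.IsReflexive) (hQ : Q.IsReflexive) :
    closureDiff k S * closureDiff k Q =
      closureDiff k (S * Q) - closureDiff k (S * Q.transClosure) -
        closureDiff k (S.transClosure * Q) + closureDiff k (S.transClosure * Q.transClosure) := by
  simp only [closureDiff, BinRel.transClosure_mul_left hS hQ, BinRel.transClosure_mul_right hQ hS,
    BinRel.transClosure_mul_right hQ.transClosure hS, map_mul]
  noncomm_ring

variable [Finite X]

/-- If `S` is transitive its difference is zero. If `SQ = S`, then `S` and `S̄` absorb both `Q` and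
`Q̄`, and the four terms cancel. Otherwise each of the four products strictly contains `S`. -/
theorem closureDiff_mul_mem {S Q : BinRel X} (hS : S.IsReflexive) (hQ : Q.IsReflexive) {j : ℕ}
    (hj : j ≤ S.size) (σ : Equiv.Perm X) :
    closureDiff k S * closureDiff k Q * essClass k (BinRel.perm σ) ∈ nilFiltration k X (j + 1) := by
  by_cases h1 : S = S.transClosure
  · rw [closureDiff, ← h1, sub_self, zero_mul, zero_mul]
    exact zero_mem _
  by_cases h2 : S * Q = S
  · have h3 := BinRel.transClosure_mul_eq h2 hQ
    rw [closureDiff_mul hS hQ, h2, BinRel.mul_transClosure_eq h2 hQ, h3,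
      BinRel.mul_transClosure_eq h3 hQ, sub_self, zero_sub, neg_add_cancel, zero_mul]
    exact zero_mem _
  have hle : ∀ x y, S.Holds x y → (S * Q).Holds x y := fun x y hxy => ⟨y, hxy, hQ y⟩
  have hlt : S.size < (S * Q).size := BinRel.size_lt hle (Ne.symm h2)
  have hlt' : S.size < S.transClosure.size := BinRel.size_lt (fun x y hxy => .single hxy) h1
  have hmem : ∀ T : BinRel X, T.IsReflexive → S.size < T.size →
      closureDiff k T * essClass k (BinRel.perm σ) ∈ nilFiltration k X (j + 1) :=
    fun T hT hST => Submodule.subset_span ⟨T, σ, hT, by omega, rfl⟩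
  have hmono : ∀ {T U : BinRel X}, (∀ x y, T.Holds x y → U.Holds x y) → T.size ≤ U.size :=
    fun h => Set.ncard_le_ncard (fun p hp => h p.1 p.2 hp) (Set.toFinite _)
  rw [closureDiff_mul hS hQ, add_mul, sub_mul, sub_mul]
  refine add_mem (sub_mem (sub_mem ?_ ?_) ?_) ?_
  · exact hmem _ (hS.mul hQ) hlt
  · exact hmem _ (hS.mul hQ.transClosure) (hlt.trans_le (hmono fun x y ⟨z, h, h'⟩ =>
      ⟨z, h, .single h'⟩))
  · exact hmem _ (hS.transClosure.mul hQ) (hlt'.trans_le (hmono fun x y h => ⟨y, h, hQ y⟩))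
  · exact hmem _ (hS.transClosure.mul hQ.transClosure)
      (hlt'.trans_le (hmono fun x y h => ⟨y, h, hQ.transClosure y⟩))

theorem mul_mem_nilFiltration {j : ℕ} {x y : EssentialAlgebra k X}
    (hx : x ∈ nilFiltration k X j) (hy : y ∈ nilSubmodule k X) :
    x * y ∈ nilFiltration k X (j + 1) := by
  induction hx using Submodule.span_induction with
  | zero => rw [zero_mul]; exact zero_mem _
  | add a b _ _ ha hb => rw [add_mul]; exact add_mem ha hb
  | smul r a _ ha => rw [smul_mul_assoc]; exact Submodule.smul_mem _ r ha
  | mem x hx =>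
    obtain ⟨S, σ, hS, hj, rfl⟩ := hx
    induction hy using Submodule.span_induction with
    | zero => rw [mul_zero]; exact zero_mem _
    | add a b _ _ ha hb => rw [mul_add]; exact add_mem ha hb
    | smul r a _ ha => rw [mul_smul_comm]; exact Submodule.smul_mem _ r ha
    | mem y hy =>
      obtain ⟨Q, τ, hQ, -, rfl⟩ := hy
      change closureDiff k S * essClass k (BinRel.perm σ) *
        (closureDiff k Q * essClass k (BinRel.perm τ)) ∈ _
      rw [mul_assoc, ← mul_assoc (essClass k (BinRel.perm σ)), perm_mul_closureDiff, mul_assoc,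
        ← map_mul, ← BinRel.perm_mul, ← mul_assoc]
      exact closureDiff_mul_mem hS (hQ.conj σ) hj _

theorem pow_succ_mem_nilFiltration {y : EssentialAlgebra k X} (hy : y ∈ nilSubmodule k X) (j : ℕ) :
    y ^ (j + 1) ∈ nilFiltration k X j := by
  induction j with
  | zero => rw [zero_add, pow_one]; exact nilSubmodule_le_nilFiltration hy
  | succ j ih => rw [pow_succ]; exact mul_mem_nilFiltration ih hy

theorem isNilpotent_of_mem_nilSubmodule {y : EssentialAlgebra k X} (hy : y ∈ nilSubmodule k X) :
    IsNilpotent y := by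
  -- No relation has more than `|X × X|` pairs, so level `|X × X| + 1` is zero; the power `j + 1`
  -- lies in level `j`, hence the second `+ 1`.
  refine ⟨Nat.card (X × X) + 1 + 1, ?_⟩
  have h := pow_succ_mem_nilFiltration hy (Nat.card (X × X) + 1)
  have hbot : nilFiltration k X (Nat.card (X × X) + 1) ≤ ⊥ := by
    rw [nilFiltration, Submodule.span_le]
    rintro _ ⟨S, σ, -, hj, -⟩
    have := S.size_le
    omega
  exact (Submodule.mem_bot k).1 (hbot h)

/-- The ideal `N` acts by zero on simple modules. -/
theorem nilSubmodule_smul_eq_zero {M : Type*} [AddCommGroup M] [Module (EssentialAlgebra k X) M]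
    [IsSimpleModule (EssentialAlgebra k X) M] {y : EssentialAlgebra k X}
    (hy : y ∈ nilSubmodule k X) (m : M) : y • m = 0 := by
  by_contra hne
  -- If `y m ≠ 0`, some `a y` fixes `m`; but `a y` lies in `N` and is nilpotent.
  obtain ⟨a, ha⟩ := IsSimpleModule.exists_smul_eq (A := EssentialAlgebra k X) hne m
  rw [smul_smul] at ha
  obtain ⟨n, hn⟩ := isNilpotent_of_mem_nilSubmodule (mul_mem_nilSubmodule a hy)
  have hpow : ∀ n : ℕ, (a * y) ^ n • m = m := by
    intro n
    induction n with
    | zero => rw [pow_zero, one_smul]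
    | succ n ih => rw [pow_succ, mul_smul, ha, ih]
  have h0 := hpow n
  rw [hn, zero_smul] at h0
  exact hne (by rw [← h0, smul_zero])

variable (k X) in
theorem bijective_restrict_toPermutedOrderAlgebra :
    Function.Bijective
      (SimpleIso.restrict (toPermutedOrderAlgebra k X).toRingHom
        (toPermutedOrderAlgebra_surjective k X) :
        SimpleIso.{max u v, w} (PermutedOrderAlgebra k X) →
          SimpleIso.{max u v, w} (EssentialAlgebra k X)) := by
  constructor
  · intro M N h
    obtain ⟨M, rfl⟩ := Quotient.exists_rep M
    obtain ⟨N, rfl⟩ := Quotient.exists_rep N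
    obtain ⟨e⟩ := SimpleMod.cls_eq_cls.1 h
    refine Quotient.sound ⟨{ e with map_smul' := fun a m => ?_ }⟩
    obtain ⟨a, rfl⟩ := toPermutedOrderAlgebra_surjective k X a
    exact e.map_smul a m
  · intro M
    obtain ⟨M, rfl⟩ := Quotient.exists_rep M
    have := M.2
    let ρ : PermutedOrderAlgebra k X →+* AddMonoid.End M.1 :=
      Ideal.Quotient.lift (nilIdeal k X) (Module.toAddMonoidEnd (EssentialAlgebra k X) M.1)
        fun a ha => AddMonoidHom.ext fun m => nilSubmodule_smul_eq_zero ha m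
    let inst : Module (PermutedOrderAlgebra k X) M.1 := Module.compHom M.1 ρ
    let f := (toPermutedOrderAlgebra k X).toRingHom
    have : RingHomSurjective f := ⟨toPermutedOrderAlgebra_surjective k X⟩
    let l : M.1 →ₛₗ[f] M.1 :=
      { toFun := fun x => x, map_add' := fun _ _ => rfl, map_smul' := fun _ _ => rfl }
    have hsimple : IsSimpleModule (PermutedOrderAlgebra k X) M.1 :=
      (LinearMap.isSimpleModule_iff_of_bijective l Function.bijective_id).1 M.2
    exact ⟨SimpleMod.cls ⟨ModuleCat.of (PermutedOrderAlgebra k X) M.1, hsimple⟩,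
      Quotient.sound ⟨{ AddEquiv.refl M.1 with map_smul' := fun _ _ => rfl }⟩⟩

end Nilpotent

/-! ### The main theorem. -/

theorem theorem8p1 (k : Type u) [Field k] (X : Type v) [Finite X] :
    Function.Bijective
      (SimpleIso.restrict (toPermutedOrderAlgebra k X).toRingHom
        (toPermutedOrderAlgebra_surjective k X) :
        SimpleIso.{max u v, max u v w} (PermutedOrderAlgebra k X) →
          SimpleIso.{max u v, max u v w} (EssentialAlgebra k X)) ∧
    (∀ R : OrderRel X, Nonempty (Unique (SimpleIso.{max u v, max u v w}
      (Matrix (Equiv.Perm X ⧸ R.stab) (Equiv.Perm X ⧸ R.stab) k)))) ∧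
    ∃ Ψ : MulAction.orbitRel.Quotient (Equiv.Perm X) (OrderPair.{u, v, max u v w} k X) ≃
        SimpleIso.{max u v, max u v w} (PermutedOrderAlgebra k X),
      (∀ s : (R : OrderRel X) → Equiv.Perm X ⧸ R.stab → Equiv.Perm X,
        (∀ R j, (QuotientGroup.mk (s R j) : Equiv.Perm X ⧸ R.stab) = j) →
        ∃ φ : (R : OrderRel X) → PermutedOrderAlgebra k X →ₐ[k]
            Matrix (Equiv.Perm X ⧸ R.stab) (Equiv.Perm X ⧸ R.stab) (MonoidAlgebra k R.stab),
          (∀ R, IsLeftMulMatrix R (s R) (φ R)) ∧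
          (∀ r : MulAction.orbitRel.Quotient (Equiv.Perm X) (OrderRel X) → OrderRel X,
            (∀ o, Quotient.mk (MulAction.orbitRel (Equiv.Perm X) (OrderRel X)) (r o) = o) →
            Function.Bijective (fun (x : PermutedOrderAlgebra k X) o => φ (r o) x)) ∧
          ∀ (R : OrderRel X) (V : SimpleMod.{max u v, max u v w} (MonoidAlgebra k R.stab))
            (W : SimpleMod.{max u v, max u v w}
              (Matrix (Equiv.Perm X ⧸ R.stab) (Equiv.Perm X ⧸ R.stab) k)),
            ∃ h : IsSimpleModule (PermutedOrderAlgebra k X)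
                (matrixTensorModule.{u, v, w} (φ R) W.1 V.1),
              Ψ (pairClass R V) = SimpleMod.cls ⟨matrixTensorModule.{u, v, w} (φ R) W.1 V.1, h⟩) ∧
      (∀ (R : OrderRel X) (V : SimpleMod.{max u v, max u v w} (MonoidAlgebra k R.stab)),
        ∃ h : IsSimpleModule (PermutedOrderAlgebra k X) (inducedModule.{u, v, w} R V.1),
          Ψ (pairClass R V) = SimpleMod.cls ⟨inducedModule.{u, v, w} R V.1, h⟩) ∧
      (∀ (R : OrderRel X) (V : SimpleMod.{max u v, max u v w} (MonoidAlgebra k R.stab))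
        (M : SimpleMod.{max u v, max u v w} (PermutedOrderAlgebra k X)),
        Ψ (pairClass R V) = M.cls →
          dimOver k V.1 < Cardinal.aleph0 ∧
          dimOver k M.1 = (R.stab.index : Cardinal) * dimOver k V.1) := by
  refine ⟨bijective_restrict_toPermutedOrderAlgebra k X, fun R =>
    nonempty_unique_simpleIso_matrix.{u, v, w} k (Equiv.Perm X ⧸ R.stab), simpleEquiv.{u, v, w},
    fun s hs => ⟨fun R => leftMulMatrix (hs R), fun R => isLeftMulMatrix_leftMulMatrix (hs R),
      fun r hr => bijective_leftMulMatrix hs hr, fun R V W => ?_⟩, fun R V => ?_,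
    fun R V M hM => ⟨dimOver_lt_aleph0 V, ?_⟩⟩
  · have h := hasCorner_matrixTensorModule.{u, v, w} (hs R) V W
    exact ⟨h.2, simpleEquiv_pairClass_eq_iff.2 h.1⟩
  · have h := hasCorner_inducedModule.{u, v, w} V
    exact ⟨h.2, simpleEquiv_pairClass_eq_iff.2 h.1⟩
  -- The dimension is read off the model `W ⊗ V`, for an arbitrary choice of representatives and of
  -- `W`.
  · obtain ⟨s, hs⟩ := exists_cosetRep R
    obtain ⟨huniq⟩ := nonempty_unique_simpleIso_matrix.{u, v, w} k (Equiv.Perm X ⧸ R.stab)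
    obtain ⟨W, -⟩ := Quotient.exists_rep huniq.default
    have h := hasCorner_matrixTensorModule.{u, v, w} hs V W
    let N : SimpleMod.{max u v, max u v w} (PermutedOrderAlgebra k X) :=
      ⟨matrixTensorModule.{u, v, w} (leftMulMatrix hs) W.1 V.1, h.2⟩
    have hN : simpleEquiv.{u, v, w} (pairClass R V) = N.cls :=
      simpleEquiv_pairClass_eq_iff.2 h.1
    obtain ⟨e⟩ := SimpleMod.cls_eq_cls.1 (hM.symm.trans hN)
    exact (dimOver_eq_of_linearEquiv e).trans (dimOver_matrixTensorModule _ V W)
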